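/- Conventions. Complex manifolds are finite-dimensional, Hausdorff and second countable. For a connected complex manifold $M$, let $\mathsf{k}_M$ be its Kobayashi pseudodistance (normalized by the Poincaré distance $\rho(a,b)=\tanh^{-1}\bigl|\tfrac{a-b}{1-\bar b a}\bigr|$ of the unit disc $\mathbb{D}$) and $\kappa_M(x;v)=\inf\{\alpha>0:\exists f:\mathbb{D}\to M \text{ holomorphic},\ f(0)=x,\ \alpha f'(0)=v\}$ its Kobayashi (Royden) pseudometric. $M$ is Kobayashi hyperbolic if $\mathsf{k}_M$ is a distance, and complete Kobayashi hyperbolic if moreover $(M,\mathsf{k}_M)$ is a complete metric space. Metric compactification. Let $C_*(M)$ be the quotient of the space $C(M)$ of real continuous functions (with locally uniform convergence) by the constants, with the quotient topology, and let $i_{\mathsf{k}}:M\to C_*(M)$, $i_{\mathsf{k}}(x)=[\mathsf{k}_M(x,\cdot)]$. Then $\overline{M}^{\mathsf{k}}$ is the closure of $i_{\mathsf{k}}(M)$ in $C_*(M)$. End compactification. Let $\Omega\subsetneq Y$ be a domain (a nonempty connected open proper subset) of a complex manifold $Y$, with closure $\overline\Omega$ in $Y$, and let $(K_j)$ be a compact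 exhaustion of $\overline\Omega$ with $K_j\subset\operatorname{int}K_{j+1}$. An end is a decreasing sequence $(F_j)$ with $F_j$ a connected component of $\overline\Omega\setminus K_j$. Then $\overline\Omega^{\rm End}$ is the disjoint union of $\overline\Omega$ and the set of ends, topologized as follows: a point of $\overline\Omega$ has its neighbourhoods in $\overline\Omega$ as a neighbourhood basis, and an end $(F_j)$ has the basis of sets $F_j\sqcup\{\text{ends }(G_\nu): G_\nu=F_\nu\text{ for all }\nu\le j\}$. Visibility. For $\lambda\ge 1$, $\kappa>0$, a $(\lambda,\kappa)$-almost-geodesic in a Kobayashi hyperbolic domain $\Omega$ is an absolutely continuous curve $\sigma:[0,T]\to\Omega$ with $\tfrac1\lambda|s-t|-\kappa\le\mathsf{k}_\Omega(\sigma(s),\sigma(t))\le\lambda|s-t|+\kappa$ for all $s,t\in[0,T]$ and $\kappa_\Omega(\sigma(t);\sigma'(t))\le\lambda$ for almost every $t$. The domain $\Omega$ satisfies the visibility property if for all $\lambda\ge1$, $\kappa>0$ and all distinct $p,q\in\partial\Omega$ there are neighbourhoods $U$ of $p$ and $V$ of $q$ in $Y$ with $\overline U\cap\overline V=\emptyset$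 and a compact set $C\subset\Omega$ such that every $(\lambda,\kappa)$-almost-geodesic $\sigma:[0,T]\to\Omega$ with $\sigma(0)\in U$ and $\sigma(T)\in V$ meets $C$. Theorem. Let $X$ be a connected complete Kobayashi hyperbolic complex manifold, and let $\Omega\subsetneq Y$ be a Kobayashi hyperbolic domain in a complex manifold $Y$ that satisfies the visibility property. Let $F:X\to\Omega$ be a continuous quasi-isometric embedding, that is, $F$ is continuous and there are $\lambda\ge1$, $\kappa\ge0$ with $$\tfrac1\lambda\,\mathsf{k}_X(x,y)-\kappa\le\mathsf{k}_\Omega(F(x),F(y))\le\lambda\,\mathsf{k}_X(x,y)+\kappa\qquad\text{for all }x,y\in X.$$ Then there is a continuous map $\widetilde F:\overline{X}^{\mathsf{k}}\to\overline\Omega^{\rm End}$ with $\widetilde F(i_{\mathsf{k}}(x))=F(x)$ for all $x\in X$. -/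

import Mathlib

open scoped Manifold Topology
open Set Filter MeasureTheory

noncomputable section

/-! ### The Kobayashi distance and the Kobayashi metric -/

/-- The Poincaré distance on the unit disc (curvature `-4`):
`ρ(a, b) = artanh (|a - b| / |1 - conj b * a|)`. -/
def poincareDist (a b : ℂ) : ℝ :=
  Real.artanh (‖a - b‖ / ‖1 - (starRingEnd ℂ) b * a‖)

section Kobayashi

variable (E : Type*) [NormedAddCommGroup E] [NormedSpace ℂ E]
variable {X : Type*} [TopologicalSpace X] [ChartedSpace E X]

/-- `f` restricts to a holomorphic map from the open unit disc to `X`. -/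
def IsHolomorphicDisc (f : ℂ → X) : Prop :=
  MDifferentiableOn 𝓘(ℂ, ℂ) 𝓘(ℂ, E) f (Metric.ball (0 : ℂ) 1)

/-- `DiscChain E x y L`: the points `x` and `y` are joined by a finite chain of holomorphic
discs `f₁, …, fₘ` with points `aᵢ, bᵢ` of the unit disc such that `f₁ a₁ = x`,
`fᵢ bᵢ = fᵢ₊₁ aᵢ₊₁`, `fₘ bₘ = y`, and `L = ∑ ρ(aᵢ, bᵢ)`. -/
inductive DiscChain : X → X → ℝ → Prop
  | nil (x : X) : DiscChain x x 0
  | cons (f : ℂ → X) (a b : ℂ) (y : X) (L : ℝ) (hf : IsHolomorphicDisc E f)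
      (ha : a ∈ Metric.ball (0 : ℂ) 1) (hb : b ∈ Metric.ball (0 : ℂ) 1)
      (h : DiscChain (f b) y L) : DiscChain (f a) y (poincareDist a b + L)

/-- The Kobayashi pseudodistance. (The infimum is over a nonempty set when `X` is connected,
see `exists_discChain`.) -/
def kobayashiDist (x y : X) : ℝ :=
  sInf {L : ℝ | DiscChain E x y L}

/-- The Kobayashi (Royden) pseudometric
`κ(x; v) = inf {α > 0 | ∃ f : 𝔻 → X holomorphic, f 0 = x, α f'(0) = v}`.
Tangent vectors at `x` are written, as everywhere in Mathlib, in the preferred chart at `x`. -/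
def kobayashiMetric (x : X) (v : E) : ℝ :=
  sInf {α : ℝ | 0 < α ∧ ∃ f : ℂ → X, IsHolomorphicDisc E f ∧ f 0 = x ∧
    (α : ℂ) • (mfderiv 𝓘(ℂ, ℂ) 𝓘(ℂ, E) f 0 (1 : ℂ) : E) = v}

variable (X) in
/-- `X` is Kobayashi hyperbolic: the Kobayashi pseudodistance separates points. -/
def IsKobayashiHyperbolic : Prop :=
  ∀ x y : X, kobayashiDist E x y = 0 → x = y

theorem poincareDist_nonneg (a b : ℂ) : 0 ≤ poincareDist a b :=
  Real.artanh_nonneg (by positivity)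

theorem poincareDist_comm (a b : ℂ) : poincareDist a b = poincareDist b a := by
  unfold poincareDist
  rw [norm_sub_rev a b]
  congr 2
  rw [← Complex.norm_conj (1 - (starRingEnd ℂ) b * a)]
  simp [mul_comm]

variable {E}

theorem DiscChain.nonneg {x y : X} {L : ℝ} (h : DiscChain E x y L) : 0 ≤ L := by
  induction h with
  | nil x => exact le_rfl
  | cons f a b y L hf ha hb h ih => exact add_nonneg (poincareDist_nonneg a b) ih

theorem DiscChain.trans {x y z : X} {L M : ℝ} (h : DiscChain E x y L) (h' : DiscChain E y z M) :
    DiscChain E x z (L + M) := by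
  induction h with
  | nil x => simpa using h'
  | cons f a b y L hf ha hb h ih =>
    rw [add_assoc]
    exact DiscChain.cons f a b z (L + M) hf ha hb (ih h')

theorem DiscChain.symm {x y : X} {L : ℝ} (h : DiscChain E x y L) : DiscChain E y x L := by
  induction h with
  | nil x => exact DiscChain.nil x
  | cons f a b y L hf ha hb h ih =>
    have h1 : DiscChain E (f b) (f a) (poincareDist b a + 0) :=
      DiscChain.cons f b a (f a) 0 hf hb ha (DiscChain.nil _)
    have h2 := ih.trans h1
    rwa [add_zero, poincareDist_comm b a, add_comm] at h2

/-- Points in a coordinate ball are joined by a holomorphic disc. -/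
theorem eventually_discChain [IsManifold 𝓘(ℂ, E) 1 X] (p : X) :
    ∀ᶠ q in 𝓝 p, ∃ L, DiscChain E p q L := by
  set φ := chartAt E p with hφ
  have hp : p ∈ φ.source := mem_chart_source E p
  obtain ⟨r, hr, hball⟩ := Metric.isOpen_iff.1 φ.open_target (φ p) (φ.map_source hp)
  have hnear : ∀ᶠ q in 𝓝 p, φ q ∈ Metric.ball (φ p) (r / 2) :=
    (φ.continuousAt hp).eventually (Metric.ball_mem_nhds _ (half_pos hr))
  filter_upwards [hnear, φ.open_source.mem_nhds hp] with q hq hqs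
  set v : E := (2 : ℂ) • (φ q - φ p) with hv
  have hvn : ‖v‖ < r := by
    rw [hv, norm_smul]
    rw [mem_ball_iff_norm] at hq
    simp only [Complex.norm_ofNat]
    linarith
  let g : ℂ → E := fun ζ => φ p + ζ • v
  have hg : MapsTo g (Metric.ball (0 : ℂ) 1) φ.target := by
    intro ζ hζ
    apply hball
    rw [mem_ball_iff_norm]
    simp only [g, add_sub_cancel_left, norm_smul]
    rw [mem_ball_zero_iff] at hζ
    calc ‖ζ‖ * ‖v‖ ≤ 1 * ‖v‖ := by gcongr
      _ < r := by linarith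
  have hgd : Differentiable ℂ g := by fun_prop
  have hf : IsHolomorphicDisc E (fun ζ => φ.symm (g ζ)) := by
    have h1 : MDifferentiableOn 𝓘(ℂ, E) 𝓘(ℂ, E) φ.symm φ.target :=
      mdifferentiableOn_atlas_symm (chart_mem_atlas E p)
    exact h1.comp hgd.mdifferentiable.mdifferentiableOn hg
  have h0 : (0 : ℂ) ∈ Metric.ball (0 : ℂ) 1 := by simp
  have h2 : (1 / 2 : ℂ) ∈ Metric.ball (0 : ℂ) 1 := by simp; norm_num
  have hc := DiscChain.cons (E := E) (fun ζ => φ.symm (g ζ)) 0 (1 / 2) _ 0 hf h0 h2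
    (DiscChain.nil _)
  have e0 : φ.symm (g 0) = p := by simp [g, φ.left_inv hp]
  have e2 : φ.symm (g (1 / 2)) = q := by
    have : g (1 / 2) = φ q := by
      simp [g, hv, smul_smul]
    rw [this, φ.left_inv hqs]
  simp only [e0, e2] at hc
  exact ⟨_, hc⟩

theorem exists_discChain [IsManifold 𝓘(ℂ, E) 1 X] [ConnectedSpace X] (x y : X) :
    ∃ L, DiscChain E x y L := by
  let S : Set X := {y | ∃ L, DiscChain E x y L}
  have hopen : IsOpen S := by
    rw [isOpen_iff_mem_nhds]
    rintro z ⟨L, hL⟩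
    filter_upwards [eventually_discChain (E := E) z] with w hw
    obtain ⟨M, hM⟩ := hw
    exact ⟨_, hL.trans hM⟩
  have hclosed : IsClosed S := by
    rw [← isOpen_compl_iff, isOpen_iff_mem_nhds]
    intro z hz
    filter_upwards [eventually_discChain (E := E) z] with w hw hw'
    obtain ⟨M, hM⟩ := hw
    obtain ⟨L, hL⟩ := hw'
    exact hz ⟨_, hL.trans hM.symm⟩
  have hS : S = univ := IsClopen.eq_univ ⟨hclosed, hopen⟩ ⟨x, 0, DiscChain.nil x⟩
  have : y ∈ S := hS ▸ mem_univ y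
  exact this

theorem kobayashiDist_le {x y : X} {L : ℝ} (h : DiscChain E x y L) : kobayashiDist E x y ≤ L :=
  csInf_le ⟨0, fun _ hM => DiscChain.nonneg hM⟩ h

theorem kobayashiDist_nonneg (x y : X) : 0 ≤ kobayashiDist E x y :=
  Real.sInf_nonneg fun _ hL => DiscChain.nonneg hL

theorem kobayashiDist_self (x : X) : kobayashiDist E x x = 0 :=
  le_antisymm (kobayashiDist_le (DiscChain.nil x)) (kobayashiDist_nonneg x x)

theorem kobayashiDist_comm (x y : X) : kobayashiDist E x y = kobayashiDist E y x := by
  unfold kobayashiDist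
  congr 1
  ext L
  exact ⟨DiscChain.symm, DiscChain.symm⟩

theorem kobayashiDist_triangle [IsManifold 𝓘(ℂ, E) 1 X] [ConnectedSpace X] (x y z : X) :
    kobayashiDist E x z ≤ kobayashiDist E x y + kobayashiDist E y z := by
  refine le_of_forall_pos_le_add fun ε hε => ?_
  obtain ⟨L, hL, hL'⟩ := exists_lt_of_csInf_lt (exists_discChain (E := E) x y)
    (show kobayashiDist E x y < kobayashiDist E x y + ε / 2 by linarith)
  obtain ⟨M, hM, hM'⟩ := exists_lt_of_csInf_lt (exists_discChain (E := E) y z)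
    (show kobayashiDist E y z < kobayashiDist E y z + ε / 2 by linarith)
  have := kobayashiDist_le (DiscChain.trans hL hM)
  linarith

variable (E) in
/-- The set `X` equipped with the Kobayashi distance `k_X`. -/
def KobayashiSpace (X : Type*) [TopologicalSpace X] [ChartedSpace E X] : Type _ := X

/-- The identity map from `X` to `(X, k_X)`. -/
def toKobayashiSpace (x : X) : KobayashiSpace E X := x

/-- `(X, k_X)` is a pseudometric space (a metric space exactly when `X` is hyperbolic). -/
instance [IsManifold 𝓘(ℂ, E) 1 X] [ConnectedSpace X] :
    PseudoMetricSpace (KobayashiSpace E X) where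
  dist := kobayashiDist (X := X) E
  dist_self := kobayashiDist_self (X := X) (E := E)
  dist_comm := kobayashiDist_comm (X := X) (E := E)
  dist_triangle := kobayashiDist_triangle (X := X) (E := E)

end Kobayashi

/-! ### The metric compactification -/

section MetricCompactification

variable (M : Type*) [PseudoMetricSpace M]

/-- The constant functions in `C(M)`. -/
def constantFunctions : AddSubgroup C(M, ℝ) where
  carrier := {f | ∃ c : ℝ, f = ContinuousMap.const M c}
  zero_mem' := ⟨0, rfl⟩
  add_mem' := by
    rintro _ _ ⟨c, rfl⟩ ⟨d, rfl⟩
    exact ⟨c + d, rfl⟩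
  neg_mem' := by
    rintro _ ⟨c, rfl⟩
    exact ⟨-c, rfl⟩

/-- `C_*(M)`: the quotient of `C(M)` (with the compact-open topology, that is, locally uniform
convergence for locally compact `M`) by the constants, with the quotient topology. -/
abbrev CStar : Type _ := C(M, ℝ) ⧸ constantFunctions M

variable {M} in
/-- The class of the function `d(x, ·)`. -/
def distClass (x : M) : CStar M :=
  QuotientAddGroup.mk (⟨fun z => dist x z, by fun_prop⟩ : C(M, ℝ))

/-- The metric (horofunction) compactification: the closure of `{[d(x, ·)]}` in `C_*(M)`. -/
def MetricCompactification : Type _ := closure (range (distClass (M := M)))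

instance : TopologicalSpace (MetricCompactification M) :=
  inferInstanceAs (TopologicalSpace (closure (range (distClass (M := M)))))

variable {M} in
/-- The canonical map `i_d`. -/
def metricEmbedding (x : M) : MetricCompactification M :=
  ⟨distClass x, subset_closure (mem_range_self x)⟩

end MetricCompactification

/-! ### The end compactification -/

section EndCompactification

variable {Z : Type*} [TopologicalSpace Z]

/-- An end of `Z` with respect to a compact exhaustion `(K_j)`: a decreasing sequence `(F_j)`
with `F_j` a connected component of `Z \ K_j`. -/
structure TopEnd (K : CompactExhaustion Z) where
  /-- The sequence of components. -/
  F : ℕ → Set Z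
  isComponent : ∀ j, ∃ x ∈ (K j)ᶜ, F j = connectedComponentIn (K j)ᶜ x
  decreasing : ∀ j, F (j + 1) ⊆ F j

/-- The end compactification of `Z`, as a set: the disjoint union of `Z` and its ends. -/
inductive EndCompactification (K : CompactExhaustion Z) : Type _
  | ofPoint (z : Z) : EndCompactification K
  | ofEnd (e : TopEnd K) : EndCompactification K

/-- The basic neighbourhood of an end `(F_j)`: the set `F_j` and the ends that agree with
`(F_j)` up to the index `j`. -/
def endNhd {K : CompactExhaustion Z} (e : TopEnd K) (j : ℕ) : Set (EndCompactification K) :=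
  EndCompactification.ofPoint '' e.F j ∪
    EndCompactification.ofEnd '' {f | ∀ ν ≤ j, f.F ν = e.F ν}

/-- The filter generated by the basic neighbourhoods of a point of the end compactification. -/
def endCompactificationNhds {K : CompactExhaustion Z} :
    EndCompactification K → Filter (EndCompactification K)
  | .ofPoint z => Filter.map EndCompactification.ofPoint (𝓝 z)
  | .ofEnd e => ⨅ j : ℕ, 𝓟 (endNhd e j)

instance (K : CompactExhaustion Z) : TopologicalSpace (EndCompactification K) :=
  TopologicalSpace.mkOfNhds endCompactificationNhds

end EndCompactification

/-! ### Almost-geodesics, visibility, quasi-isometric embeddings -/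

section Visibility

variable (E : Type*) [NormedAddCommGroup E] [NormedSpace ℂ E]

/-- `σ : [0, T] → X` is absolutely continuous: it is continuous, and absolutely continuous in
charts. Only the values of `σ` on `[0, T]` matter. -/
def IsAbsolutelyContinuousCurve {X : Type*} [TopologicalSpace X] [ChartedSpace E X]
    (T : ℝ) (σ : ℝ → X) : Prop :=
  ContinuousOn σ (Icc 0 T) ∧
    ∀ (p : X) (a b : ℝ), 0 ≤ a → a ≤ b → b ≤ T → MapsTo σ (Icc a b) (chartAt E p).source →
      AbsolutelyContinuousOnInterval (fun s => chartAt E p (σ s)) a b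

/-- `σ : [0, T] → X` is a `(lam, kap)`-almost-geodesic for the Kobayashi distance. The velocity
`σ'(t)` is written in the preferred chart at `σ t`. -/
structure IsAlmostGeodesic {X : Type*} [TopologicalSpace X] [ChartedSpace E X]
    (lam kap T : ℝ) (σ : ℝ → X) : Prop where
  lower : ∀ s ∈ Icc 0 T, ∀ t ∈ Icc 0 T,
    1 / lam * |s - t| - kap ≤ kobayashiDist E (σ s) (σ t)
  upper : ∀ s ∈ Icc 0 T, ∀ t ∈ Icc 0 T,
    kobayashiDist E (σ s) (σ t) ≤ lam * |s - t| + kap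
  absCont : IsAbsolutelyContinuousCurve E T σ
  speed : ∀ᵐ t ∂(volume.restrict (Icc 0 T)),
    ∃ v : E, HasDerivAt (fun s => chartAt E (σ t) (σ s)) v t ∧ kobayashiMetric E (σ t) v ≤ lam

/-- The domain `Ω ⊆ Y` has the visibility property with respect to all
`(lam, kap)`-almost-geodesics, `lam ≥ 1`, `kap > 0`: for distinct boundary points `p, q ∈ ∂Ω`,
almost-geodesics that join points near `p` to points near `q` meet a fixed compact subset
of `Ω`. -/
def HasVisibilityProperty {Y : Type*} [TopologicalSpace Y] [ChartedSpace E Y]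
    (Ω : TopologicalSpace.Opens Y) : Prop :=
  ∀ lam kap : ℝ, 1 ≤ lam → 0 < kap →
    ∀ p ∈ frontier (Ω : Set Y), ∀ q ∈ frontier (Ω : Set Y), p ≠ q →
      ∃ U ∈ 𝓝 p, ∃ V ∈ 𝓝 q, Disjoint (closure U) (closure V) ∧
        ∃ C : Set Ω, IsCompact C ∧
          ∀ (T : ℝ) (σ : ℝ → Ω), 0 ≤ T → IsAlmostGeodesic E lam kap T σ →
            (σ 0 : Y) ∈ U → (σ T : Y) ∈ V → ∃ t ∈ Icc 0 T, σ t ∈ C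

/-- `F : (X, k_X) → (X', k_X')` is a quasi-isometric embedding. -/
def IsQuasiIsometricEmbedding (E' : Type*) [NormedAddCommGroup E'] [NormedSpace ℂ E']
    {X X' : Type*} [TopologicalSpace X] [ChartedSpace E X]
    [TopologicalSpace X'] [ChartedSpace E' X'] (F : X → X') : Prop :=
  ∃ lam kap : ℝ, 1 ≤ lam ∧ 0 ≤ kap ∧ ∀ x y : X,
    1 / lam * kobayashiDist E x y - kap ≤ kobayashiDist E' (F x) (F y) ∧
      kobayashiDist E' (F x) (F y) ≤ lam * kobayashiDist E x y + kap

end Visibility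

end

noncomputable section

/-!
Let `ξ` be a boundary point of the metric compactification of `X`, the class of a function `h`.
Almost shortest curves joining points near `ξ` avoid any given ball: along such a curve `γ` on
`[0, T]` the distance to `γ 0` increases and the distance to `γ T` decreases, while on the ball the
increments of both are close to those of `h`. The images of these curves under `F` are shadowed by
subunit quasi-geodesics of `Ω`, which therefore avoid any given compact subset of `Ω`. By visibility
such quasi-geodesics cannot meet both of two disjoint compact subsets of the closure of `Ω`. So the
images of points near `ξ` are joined by connected sets that do not meet both, which forces `F` to
converge at `ξ` to a point of the closure of `Ω` or to an end.
-/

/-! ### The unit disc -/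

/-- The automorphism of the unit disc that maps `0` to `a`. -/
def discAut (a ζ : ℂ) : ℂ := (ζ + a) / (1 + (starRingEnd ℂ) a * ζ)

theorem one_add_conj_mul_ne_zero {a ζ : ℂ} (ha : ‖a‖ < 1) (hζ : ‖ζ‖ < 1) :
    1 + (starRingEnd ℂ) a * ζ ≠ 0 := by
  intro h
  have h1 : ‖a‖ * ‖ζ‖ = 1 := by
    simpa using congrArg norm (eq_neg_of_add_eq_zero_right h)
  nlinarith [norm_nonneg a, norm_nonneg ζ]

theorem norm_discAut_lt_one {a ζ : ℂ} (ha : ‖a‖ < 1) (hζ : ‖ζ‖ < 1) : ‖discAut a ζ‖ < 1 := by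
  rw [discAut, norm_div, div_lt_one (norm_pos_iff.2 (one_add_conj_mul_ne_zero ha hζ))]
  refine lt_of_pow_lt_pow_left₀ 2 (norm_nonneg _) ?_
  have ha2 : ‖a‖ ^ 2 < 1 := by nlinarith [norm_nonneg a]
  have hz2 : ‖ζ‖ ^ 2 < 1 := by nlinarith [norm_nonneg ζ]
  -- `|1 + conj a * ζ|² - |ζ + a|² = (1 - |a|²) (1 - |ζ|²)`
  simp only [Complex.sq_norm, Complex.normSq_apply, Complex.add_re, Complex.add_im, Complex.one_re,
    Complex.one_im, Complex.mul_re, Complex.mul_im, Complex.conj_re, Complex.conj_im] at *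
  nlinarith [mul_pos (sub_pos.2 ha2) (sub_pos.2 hz2)]

theorem discAut_zero (a : ℂ) : discAut a 0 = a := by simp [discAut]

theorem differentiableAt_discAut {a ζ : ℂ} (ha : ‖a‖ < 1) (hζ : ‖ζ‖ < 1) :
    DifferentiableAt ℂ (discAut a) ζ :=
  DifferentiableAt.div (by fun_prop) (by fun_prop) (one_add_conj_mul_ne_zero ha hζ)

theorem discAut_discAut_neg {a b : ℂ} (ha : ‖a‖ < 1) (hb : ‖b‖ < 1) :
    discAut a (discAut (-a) b) = b := by
  have h0 := one_add_conj_mul_ne_zero (a := -a) (by rwa [norm_neg]) hb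
  have h1 := one_add_conj_mul_ne_zero (a := -a) (by rwa [norm_neg]) ha
  have e1 : discAut (-a) b + a = b * ((1 + (starRingEnd ℂ) (-a) * a) /
      (1 + (starRingEnd ℂ) (-a) * b)) := by
    rw [discAut, div_add' _ _ _ h0, ← mul_div_assoc, map_neg]
    ring
  have e2 : 1 + (starRingEnd ℂ) a * discAut (-a) b = (1 + (starRingEnd ℂ) (-a) * a) /
      (1 + (starRingEnd ℂ) (-a) * b) := by
    rw [discAut, ← mul_div_assoc, add_div' _ _ _ h0, map_neg]
    ring
  rw [discAut, e1, e2, mul_div_cancel_right₀ _ (div_ne_zero h1 h0)]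

theorem poincareDist_eq_artanh_discAut (a b : ℂ) :
    poincareDist a b = Real.artanh ‖discAut (-a) b‖ := by
  rw [poincareDist_comm, poincareDist, discAut, norm_div, map_neg, neg_mul, ← sub_eq_add_neg,
    ← sub_eq_add_neg]

theorem tanh_poincareDist {a b : ℂ} (ha : ‖a‖ < 1) (hb : ‖b‖ < 1) :
    Real.tanh (poincareDist a b) = ‖discAut (-a) b‖ := by
  rw [poincareDist_eq_artanh_discAut, Real.tanh_artanh]
  exact ⟨neg_one_lt_zero.trans_le (norm_nonneg _), norm_discAut_lt_one (by rwa [norm_neg]) hb⟩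

theorem tanh_add (s t : ℝ) :
    Real.tanh (s + t) = (Real.tanh s + Real.tanh t) / (1 + Real.tanh t * Real.tanh s) := by
  have hs := (Real.cosh_pos s).ne'
  have ht := (Real.cosh_pos t).ne'
  have hst := (Real.cosh_pos (s + t)).ne'
  have h1 : 1 + Real.tanh t * Real.tanh s = Real.cosh (s + t) / (Real.cosh s * Real.cosh t) := by
    rw [Real.cosh_add, Real.tanh_eq_sinh_div_cosh, Real.tanh_eq_sinh_div_cosh]
    field_simp
  rw [h1, Real.tanh_eq_sinh_div_cosh, Real.tanh_eq_sinh_div_cosh, Real.tanh_eq_sinh_div_cosh,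
    Real.sinh_add]
  field_simp

theorem contDiff_tanh {n : WithTop ℕ∞} : ContDiff ℝ n Real.tanh := by
  rw [show Real.tanh = fun t => Real.sinh t / Real.cosh t from
    funext Real.tanh_eq_sinh_div_cosh]
  exact Real.contDiff_sinh.div Real.contDiff_cosh fun t => (Real.cosh_pos t).ne'

theorem hasDerivAt_tanh_zero : HasDerivAt Real.tanh 1 0 := by
  rw [show Real.tanh = fun t => Real.sinh t / Real.cosh t from
    funext Real.tanh_eq_sinh_div_cosh]
  simpa using (Real.hasDerivAt_sinh 0).fun_div (Real.hasDerivAt_cosh 0) (Real.cosh_pos 0).ne'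

theorem norm_ofReal_tanh (t : ℝ) : ‖(Real.tanh t : ℂ)‖ = Real.tanh |t| := by
  have h : ∀ {r : ℝ}, 0 ≤ r → 0 ≤ Real.tanh r := fun hr => by
    rw [Real.tanh_eq_sinh_div_cosh]
    exact div_nonneg (Real.sinh_nonneg_iff.2 hr) (Real.cosh_pos _).le
  rw [Complex.norm_real, Real.norm_eq_abs]
  rcases abs_cases t with ⟨ht, h0⟩ | ⟨ht, h0⟩
  · rw [ht, abs_of_nonneg (h h0)]
  · rw [ht, ← abs_neg, ← Real.tanh_neg, abs_of_nonneg (h (neg_nonneg.2 h0.le))]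

theorem norm_ofReal_tanh_lt_one (t : ℝ) : ‖(Real.tanh t : ℂ)‖ < 1 :=
  (norm_ofReal_tanh t).trans_lt (Real.tanh_lt_one _)

theorem discAut_tanh (s t : ℝ) :
    discAut (Real.tanh t : ℂ) (Real.tanh s : ℂ) = (Real.tanh (s + t) : ℝ) := by
  rw [discAut, Complex.conj_ofReal, tanh_add]
  push_cast
  rfl

theorem poincareDist_tanh (s t : ℝ) :
    poincareDist (Real.tanh s : ℂ) (Real.tanh t : ℂ) = |s - t| := by
  rw [poincareDist_eq_artanh_discAut, ← Complex.ofReal_neg, ← Real.tanh_neg, discAut_tanh,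
    norm_ofReal_tanh, Real.artanh_tanh, ← sub_eq_add_neg, abs_sub_comm]

theorem exists_disc_selfMap {a b : ℂ} (ha : ‖a‖ < 1) (hb : ‖b‖ < 1) :
    ∃ g : ℂ → ℂ, (∀ ζ, ‖ζ‖ < 1 → DifferentiableAt ℂ g ζ ∧ ‖g ζ‖ < 1) ∧ g 0 = a ∧
      g (Real.tanh (poincareDist a b) : ℂ) = b := by
  obtain ⟨u, hu, huw⟩ := Complex.exists_norm_mul_eq_self (discAut (-a) b)
  have hu' : ∀ ζ : ℂ, ‖ζ‖ < 1 → ‖u * ζ‖ < 1 := fun ζ hζ => by rwa [norm_mul, hu, one_mul]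
  refine ⟨fun ζ => discAut a (u * ζ), fun ζ hζ => ⟨?_, norm_discAut_lt_one ha (hu' ζ hζ)⟩, ?_, ?_⟩
  · exact (differentiableAt_discAut ha (hu' ζ hζ)).comp ζ (by fun_prop)
  · simp only [mul_zero, discAut_zero]
  · simp only [tanh_poincareDist ha hb, huw, discAut_discAut_neg ha hb]

/-! ### Holomorphic discs and the Kobayashi distance -/

section Discs

variable {E : Type*} [NormedAddCommGroup E] [NormedSpace ℂ E]
variable {X : Type*} [TopologicalSpace X] [ChartedSpace E X] {f : ℂ → X}

theorem IsHolomorphicDisc.comp (hf : IsHolomorphicDisc E f) {g : ℂ → ℂ}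
    (hg : ∀ ζ, ‖ζ‖ < 1 → DifferentiableAt ℂ g ζ ∧ ‖g ζ‖ < 1) :
    IsHolomorphicDisc E (fun ζ => f (g ζ)) := by
  have hg' : MDifferentiableOn 𝓘(ℂ, ℂ) 𝓘(ℂ, ℂ) g (Metric.ball (0 : ℂ) 1) := by
    rw [mdifferentiableOn_iff_differentiableOn]
    exact fun ζ hζ => (hg ζ (mem_ball_zero_iff.1 hζ)).1.differentiableWithinAt
  exact MDifferentiableOn.comp (I' := 𝓘(ℂ, ℂ)) hf hg' fun ζ hζ =>
    mem_ball_zero_iff.2 (hg ζ (mem_ball_zero_iff.1 hζ)).2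

theorem IsHolomorphicDisc.analyticAt_chart [IsManifold 𝓘(ℂ, E) 1 X] [CompleteSpace E]
    (hf : IsHolomorphicDisc E f) (p : X) {ζ : ℂ} (hζ : ‖ζ‖ < 1)
    (h : f ζ ∈ (chartAt E p).source) : AnalyticAt ℂ (fun w => chartAt E p (f w)) ζ := by
  have hopen : IsOpen (Metric.ball (0 : ℂ) 1 ∩ f ⁻¹' (chartAt E p).source) :=
    (MDifferentiableOn.continuousOn hf).isOpen_inter_preimage Metric.isOpen_ball
      (chartAt E p).open_source
  have hd : DifferentiableOn ℂ (fun w => chartAt E p (f w))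
      (Metric.ball (0 : ℂ) 1 ∩ f ⁻¹' (chartAt E p).source) := by
    rw [← mdifferentiableOn_iff_differentiableOn]
    have hchart : MDifferentiableOn 𝓘(ℂ, E) 𝓘(ℂ, E) (chartAt E p) (chartAt E p).source :=
      mdifferentiableOn_atlas (chart_mem_atlas E p)
    exact hchart.comp (MDifferentiableOn.mono hf inter_subset_left) fun w hw => hw.2
  exact hd.analyticAt (hopen.mem_nhds ⟨mem_ball_zero_iff.2 hζ, h⟩)

theorem IsHolomorphicDisc.mfderiv_zero (hf : IsHolomorphicDisc E f) :
    (mfderiv 𝓘(ℂ, ℂ) 𝓘(ℂ, E) f 0 (1 : ℂ) : E)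
      = deriv (fun w => chartAt E (f 0) (f w)) 0 := by
  have hd : MDifferentiableAt 𝓘(ℂ, ℂ) 𝓘(ℂ, E) f 0 :=
    MDifferentiableOn.mdifferentiableAt hf (Metric.ball_mem_nhds _ one_pos)
  rw [hd.mfderiv]
  simp only [writtenInExtChartAt, extChartAt, mfld_simps, Function.comp_def, fderivWithin_univ]
  rfl

theorem IsHolomorphicDisc.kobayashiMetric_deriv_le_one (hf : IsHolomorphicDisc E f) :
    kobayashiMetric E (f 0) (deriv (fun w => chartAt E (f 0) (f w)) 0) ≤ 1 := by
  refine csInf_le ⟨0, fun _ h => h.1.le⟩ ⟨one_pos, f, hf, rfl, ?_⟩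
  rw [Complex.ofReal_one, one_smul, hf.mfderiv_zero]

theorem IsHolomorphicDisc.exists_hasDerivAt_tanh_zero [IsManifold 𝓘(ℂ, E) 1 X] [CompleteSpace E]
    (hf : IsHolomorphicDisc E f) :
    ∃ v : E, HasDerivAt (fun s : ℝ => chartAt E (f 0) (f (Real.tanh s : ℂ))) v 0 ∧
      kobayashiMetric E (f 0) v ≤ 1 := by
  have hd : HasDerivAt (fun w => chartAt E (f 0) (f w))
      (deriv (fun w => chartAt E (f 0) (f w)) 0) ((Real.tanh 0 : ℝ) : ℂ) := by
    rw [Real.tanh_zero, Complex.ofReal_zero]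
    exact (hf.analyticAt_chart _ (by simp) (mem_chart_source E _)).differentiableAt.hasDerivAt
  have htanh : HasDerivAt (fun s : ℝ => (Real.tanh s : ℂ)) 1 0 :=
    hasDerivAt_tanh_zero.ofReal_comp
  have hcomp := HasDerivAt.scomp (h := fun s : ℝ => (Real.tanh s : ℂ)) 0 hd htanh
  rw [one_smul] at hcomp
  exact ⟨_, hcomp, hf.kobayashiMetric_deriv_le_one⟩

theorem IsHolomorphicDisc.exists_hasDerivAt_tanh [IsManifold 𝓘(ℂ, E) 1 X] [CompleteSpace E]
    (hf : IsHolomorphicDisc E f) (t : ℝ) :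
    ∃ v : E, HasDerivAt (fun s : ℝ =>
        chartAt E (f (Real.tanh t : ℂ)) (f (Real.tanh s : ℂ))) v t ∧
      kobayashiMetric E (f (Real.tanh t : ℂ)) v ≤ 1 := by
  have ht := norm_ofReal_tanh_lt_one t
  have hg : IsHolomorphicDisc E (fun ζ => f (discAut (Real.tanh t : ℂ) ζ)) :=
    hf.comp fun ζ hζ => ⟨differentiableAt_discAut ht hζ, norm_discAut_lt_one ht hζ⟩
  obtain ⟨v, hv, hv'⟩ := hg.exists_hasDerivAt_tanh_zero
  simp only [discAut_zero, discAut_tanh] at hv hv'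
  have hshift := HasDerivAt.comp_sub_const t t (by rwa [sub_self])
  simp only [sub_add_cancel] at hshift
  exact ⟨v, hshift, hv'⟩

theorem IsHolomorphicDisc.kobayashiDist_tanh_le (hf : IsHolomorphicDisc E f) (s t : ℝ) :
    kobayashiDist E (f (Real.tanh s : ℂ)) (f (Real.tanh t : ℂ)) ≤ |s - t| := by
  have h := DiscChain.cons f _ _ _ 0 hf (mem_ball_zero_iff.2 (norm_ofReal_tanh_lt_one s))
    (mem_ball_zero_iff.2 (norm_ofReal_tanh_lt_one t)) (DiscChain.nil _)
  rw [add_zero, poincareDist_tanh] at h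
  exact kobayashiDist_le h

end Discs

/-! ### Subunit curves -/

theorem lipschitzOnWith_Icc_union {V : Type*} [PseudoMetricSpace V] {f : ℝ → V} {a b c : ℝ}
    {K : NNReal} (h1 : LipschitzOnWith K f (Icc a b)) (h2 : LipschitzOnWith K f (Icc b c)) :
    LipschitzOnWith K f (Icc a c) := by
  have hle : ∀ s ∈ Icc a c, ∀ t ∈ Icc a c, s ≤ t → dist (f s) (f t) ≤ K * dist s t := by
    intro s hs t ht hst
    rcases le_total t b with htb | htb
    · exact h1.dist_le_mul s ⟨hs.1, hst.trans htb⟩ t ⟨ht.1, htb⟩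
    rcases le_total s b with hsb | hsb
    · have hsb_le := h1.dist_le_mul s ⟨hs.1, hsb⟩ b ⟨hs.1.trans hsb, le_rfl⟩
      have hbt_le := h2.dist_le_mul b ⟨le_rfl, htb.trans ht.2⟩ t ⟨htb, ht.2⟩
      have hsplit : dist s t = dist s b + dist b t := by
        rw [dist_comm s t, dist_comm s b, dist_comm b t, Real.dist_eq, Real.dist_eq, Real.dist_eq,
          abs_of_nonneg (sub_nonneg.2 hst), abs_of_nonneg (sub_nonneg.2 hsb),
          abs_of_nonneg (sub_nonneg.2 htb)]
        ring
      rw [hsplit, mul_add]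
      exact (dist_triangle _ _ _).trans (add_le_add hsb_le hbt_le)
    · exact h2.dist_le_mul s ⟨hsb, hs.2⟩ t ⟨htb, ht.2⟩
  refine LipschitzOnWith.of_dist_le_mul fun s hs t ht => ?_
  rcases le_total s t with h | h
  · exact hle s hs t ht h
  · rw [dist_comm, dist_comm s]
    exact hle t ht s hs h

theorem lipschitzOnWith_comp_add_right {V : Type*} [PseudoMetricSpace V] {f : ℝ → V} {a b : ℝ}
    {K : NNReal} (h : LipschitzOnWith K f (Icc a b)) (r : ℝ) :
    LipschitzOnWith K (fun t => f (t + r)) (Icc (a - r) (b - r)) := by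
  have := h.comp (Isometry.lipschitz (isometry_add_right r)).lipschitzOnWith
    (s := Icc (a - r) (b - r)) fun t ht => ⟨by linarith [ht.1], by linarith [ht.2]⟩
  rwa [mul_one] at this

section Subunit

variable {E : Type*} [NormedAddCommGroup E] [NormedSpace ℂ E]
variable {X : Type*} [TopologicalSpace X] [ChartedSpace E X] [IsManifold 𝓘(ℂ, E) 1 X]
  [ConnectedSpace X]

variable (E) in
/-- The restriction of `σ` to `[a, b]` is a curve of Kobayashi speed at most one: it is
`1`-Lipschitz for the Kobayashi distance, Lipschitz in charts, and its velocity, which exists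
outside a countable set, has Kobayashi length at most one. -/
structure IsSubunitCurve (σ : ℝ → X) (a b : ℝ) : Prop where
  continuousOn : ContinuousOn σ (Icc a b)
  lipschitz : LipschitzOnWith 1 (fun t => toKobayashiSpace (E := E) (σ t)) (Icc a b)
  lipschitz_chart : ∀ (p : X) (c d : ℝ), a ≤ c → d ≤ b →
    MapsTo σ (Icc c d) (chartAt E p).source →
    ∃ K, LipschitzOnWith K (fun s => chartAt E p (σ s)) (Icc c d)
  speed : ∃ N : Set ℝ, N.Countable ∧ ∀ t ∈ Ioo a b, t ∉ N →
    ∃ v : E, HasDerivAt (fun s => chartAt E (σ t) (σ s)) v t ∧ kobayashiMetric E (σ t) v ≤ 1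

theorem dist_toKobayashiSpace (x y : X) :
    dist (toKobayashiSpace (E := E) x) (toKobayashiSpace y) = kobayashiDist E x y := rfl

theorem IsSubunitCurve.dist_le {σ : ℝ → X} {a b : ℝ} (h : IsSubunitCurve E σ a b) {s t : ℝ}
    (hs : s ∈ Icc a b) (ht : t ∈ Icc a b) : kobayashiDist E (σ s) (σ t) ≤ |s - t| := by
  simpa [dist_toKobayashiSpace, Real.dist_eq] using h.lipschitz.dist_le_mul s hs t ht

theorem IsHolomorphicDisc.isSubunitCurve [CompleteSpace E] {f : ℂ → X}
    (hf : IsHolomorphicDisc E f) (a b : ℝ) :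
    IsSubunitCurve E (fun t => f (Real.tanh t : ℂ)) a b where
  continuousOn :=
    (MDifferentiableOn.continuousOn hf).comp
      (Complex.continuous_ofReal.comp (contDiff_tanh (n := 0)).continuous).continuousOn
      fun t _ => mem_ball_zero_iff.2 (norm_ofReal_tanh_lt_one t)
  lipschitz := LipschitzOnWith.mk_one fun s _ t _ => hf.kobayashiDist_tanh_le s t
  lipschitz_chart p c d _ _ hm := by
    refine LocallyLipschitzOn.exists_lipschitzOnWith_of_compact isCompact_Icc fun t ht => ?_
    have hchart : ContDiffAt ℝ 1 (fun w => chartAt E p (f w)) (Real.tanh t : ℂ) :=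
      (hf.analyticAt_chart p (norm_ofReal_tanh_lt_one t) (hm ht)).contDiffAt.restrict_scalars ℝ
    have htanh : ContDiffAt ℝ 1 (fun s : ℝ => (Real.tanh s : ℂ)) t :=
      (Complex.ofRealCLM.contDiff.comp contDiff_tanh).contDiffAt
    obtain ⟨K, u, hu, hK⟩ := (ContDiffAt.comp t hchart htanh).exists_lipschitzOnWith
    exact ⟨K, u, mem_nhdsWithin_of_mem_nhds hu, hK⟩
  speed := ⟨∅, countable_empty, fun t _ _ => hf.exists_hasDerivAt_tanh t⟩

theorem isSubunitCurve_const [CompleteSpace E] (x : X) (a b : ℝ) :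
    IsSubunitCurve E (fun _ => x) a b :=
  IsHolomorphicDisc.isSubunitCurve (f := fun _ => x) mdifferentiableOn_const a b

namespace IsSubunitCurve

variable {σ τ : ℝ → X} {a b c : ℝ}

theorem mono (h : IsSubunitCurve E σ a b) {c d : ℝ} (hac : a ≤ c) (hdb : d ≤ b) :
    IsSubunitCurve E σ c d where
  continuousOn := h.continuousOn.mono (Icc_subset_Icc hac hdb)
  lipschitz := h.lipschitz.mono (Icc_subset_Icc hac hdb)
  lipschitz_chart p c' d' h1 h2 := h.lipschitz_chart p c' d' (hac.trans h1) (h2.trans hdb)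
  speed := by
    obtain ⟨N, hN, hs⟩ := h.speed
    exact ⟨N, hN, fun t ht => hs t (Ioo_subset_Ioo hac hdb ht)⟩

theorem congr (h : IsSubunitCurve E σ a b) (he : EqOn τ σ (Icc a b)) :
    IsSubunitCurve E τ a b where
  continuousOn := h.continuousOn.congr he
  lipschitz s hs t ht := by
    simpa only [he hs, he ht] using h.lipschitz hs ht
  lipschitz_chart p c d h1 h2 hm := by
    have he' : EqOn τ σ (Icc c d) := he.mono (Icc_subset_Icc h1 h2)
    obtain ⟨K, hK⟩ := h.lipschitz_chart p c d h1 h2 (hm.congr he')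
    exact ⟨K, fun s hs t ht => by simpa only [he' hs, he' ht] using hK hs ht⟩
  speed := by
    obtain ⟨N, hN, hs⟩ := h.speed
    refine ⟨N, hN, fun t ht htN => ?_⟩
    obtain ⟨v, hv, hv'⟩ := hs t ht htN
    rw [he (Ioo_subset_Icc_self ht)]
    refine ⟨v, hv.congr_of_eventuallyEq ?_, hv'⟩
    filter_upwards [Icc_mem_nhds ht.1 ht.2] with s hs
    rw [he hs]

theorem comp_add_right (h : IsSubunitCurve E σ a b) (r : ℝ) :
    IsSubunitCurve E (fun t => σ (t + r)) (a - r) (b - r) where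
  continuousOn := h.continuousOn.comp (by fun_prop) fun t ht =>
    ⟨by linarith [ht.1], by linarith [ht.2]⟩
  lipschitz := lipschitzOnWith_comp_add_right h.lipschitz r
  lipschitz_chart p c d h1 h2 hm := by
    obtain ⟨K, hK⟩ := h.lipschitz_chart p (c + r) (d + r) (by linarith) (by linarith)
      fun t ht => by
        simpa using hm (x := t - r) ⟨by linarith [ht.1], by linarith [ht.2]⟩
    exact ⟨K, by simpa using lipschitzOnWith_comp_add_right hK r⟩
  speed := by
    obtain ⟨N, hN, hs⟩ := h.speed
    refine ⟨(fun t => t + r) ⁻¹' N, hN.preimage (add_left_injective r), fun t ht htN => ?_⟩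
    obtain ⟨v, hv, hv'⟩ := hs (t + r) ⟨by linarith [ht.1], by linarith [ht.2]⟩ htN
    exact ⟨v, HasDerivAt.comp_add_const t r hv, hv'⟩

theorem trans (hab : a ≤ b) (hbc : b ≤ c) (h1 : IsSubunitCurve E σ a b)
    (h2 : IsSubunitCurve E σ b c) : IsSubunitCurve E σ a c where
  continuousOn := by
    rw [← Icc_union_Icc_eq_Icc hab hbc]
    exact h1.continuousOn.union_of_isClosed h2.continuousOn isClosed_Icc isClosed_Icc
  lipschitz := lipschitzOnWith_Icc_union h1.lipschitz h2.lipschitz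
  lipschitz_chart p c' d' h1' h2' hm := by
    rcases le_total d' b with hd | hd
    · exact h1.lipschitz_chart p c' d' h1' hd hm
    rcases le_total b c' with hc | hc
    · exact h2.lipschitz_chart p c' d' hc h2' hm
    obtain ⟨K, hK⟩ := h1.lipschitz_chart p c' b h1' le_rfl
      (hm.mono_left (Icc_subset_Icc_right hd))
    obtain ⟨L, hL⟩ := h2.lipschitz_chart p b d' le_rfl h2'
      (hm.mono_left (Icc_subset_Icc_left hc))
    exact ⟨max K L, lipschitzOnWith_Icc_union (hK.weaken (le_max_left _ _))
      (hL.weaken (le_max_right _ _))⟩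
  speed := by
    obtain ⟨N, hN, hs⟩ := h1.speed
    obtain ⟨N', hN', hs'⟩ := h2.speed
    refine ⟨insert b (N ∪ N'), (hN.union hN').insert b, fun t ht htN => ?_⟩
    rw [mem_insert_iff, not_or, mem_union, not_or] at htN
    rcases lt_or_gt_of_ne htN.1 with h | h
    · exact hs t ⟨ht.1, h⟩ htN.2.1
    · exact hs' t ⟨h, ht.2⟩ htN.2.2

theorem exists_concat (hab : a ≤ b) {L : ℝ} (hL : 0 ≤ L) (h1 : IsSubunitCurve E σ a b)
    (h2 : IsSubunitCurve E τ 0 L) (he : σ b = τ 0) :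
    ∃ ρ : ℝ → X, IsSubunitCurve E ρ a (b + L) ∧ (∀ t ≤ b, ρ t = σ t) ∧ ρ (b + L) = τ L := by
  let ρ : ℝ → X := fun t => if t ≤ b then σ t else τ (t + -b)
  have hρσ : ∀ t ≤ b, ρ t = σ t := fun t ht => if_pos ht
  have hρτ : ∀ t, b ≤ t → ρ t = τ (t + -b) := fun t ht => by
    rcases ht.eq_or_lt with rfl | ht
    · rw [hρσ b le_rfl, he, add_neg_cancel]
    · exact if_neg ht.not_ge
  have h2' : IsSubunitCurve E (fun t => τ (t + -b)) b (b + L) := by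
    simpa [add_comm] using h2.comp_add_right (-b)
  refine ⟨ρ, ?_, hρσ, by rw [hρτ _ (by linarith), add_neg_cancel_comm]⟩
  exact (h1.congr fun t ht => hρσ t ht.2).trans hab (by linarith) (h2'.congr fun t ht => hρτ t ht.1)

theorem isAlmostGeodesic {lam kap T : ℝ} (h : IsSubunitCurve E σ 0 T) (hlam : 1 ≤ lam)
    (hkap : 0 ≤ kap)
    (hl : ∀ s ∈ Icc 0 T, ∀ t ∈ Icc 0 T, 1 / lam * |s - t| - kap ≤ kobayashiDist E (σ s) (σ t)) :
    IsAlmostGeodesic E lam kap T σ where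
  lower := hl
  upper s hs t ht := by
    have := h.dist_le hs ht
    nlinarith [abs_nonneg (s - t)]
  absCont := by
    refine ⟨h.continuousOn, fun p a b ha hab hb hm => ?_⟩
    obtain ⟨K, hK⟩ := h.lipschitz_chart p a b ha hb hm
    rw [← uIcc_of_le hab] at hK
    exact hK.absolutelyContinuousOnInterval
  speed := by
    obtain ⟨N, hN, hs⟩ := h.speed
    rw [ae_restrict_iff' measurableSet_Icc]
    filter_upwards [(hN.union (Set.toFinite {0, T}).countable).ae_notMem volume] with t ht htI
    simp only [mem_union, mem_insert_iff, mem_singleton_iff, not_or] at ht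
    obtain ⟨v, hv, hv'⟩ := hs t ⟨htI.1.lt_of_ne' ht.2.1, htI.2.lt_of_ne ht.2.2⟩ ht.1
    exact ⟨v, hv, hv'.trans hlam⟩

end IsSubunitCurve

theorem DiscChain.exists_isSubunitCurve [CompleteSpace E] {x y : X} {L : ℝ}
    (h : DiscChain E x y L) : ∃ σ : ℝ → X, IsSubunitCurve E σ 0 L ∧ σ 0 = x ∧ σ L = y := by
  induction h with
  | nil x => exact ⟨fun _ => x, isSubunitCurve_const x 0 0, rfl, rfl⟩
  | cons f a b y L hf ha hb h ih =>
    obtain ⟨τ, hτ, hτ0, hτL⟩ := ih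
    obtain ⟨g, hg, hg0, hgb⟩ :=
      exists_disc_selfMap (mem_ball_zero_iff.1 ha) (mem_ball_zero_iff.1 hb)
    obtain ⟨ρ, hρ, hρσ, hρL⟩ := ((hf.comp hg).isSubunitCurve 0 _).exists_concat
      (poincareDist_nonneg a b) h.nonneg hτ (by rw [hgb, hτ0])
    refine ⟨ρ, hρ, ?_, hρL.trans hτL⟩
    rw [hρσ 0 (poincareDist_nonneg a b), Real.tanh_zero, Complex.ofReal_zero, hg0]

theorem exists_isSubunitCurve [CompleteSpace E] {x y : X} {L : ℝ} (h : kobayashiDist E x y < L) :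
    ∃ σ : ℝ → X, IsSubunitCurve E σ 0 L ∧ σ 0 = x ∧ σ L = y := by
  obtain ⟨M, hM, hML⟩ := exists_lt_of_csInf_lt (exists_discChain (E := E) x y) h
  obtain ⟨σ, hσ, hσ0, hσM⟩ := DiscChain.exists_isSubunitCurve hM
  obtain ⟨ρ, hρ, hρσ, hρL⟩ := hσ.exists_concat hM.nonneg (sub_nonneg.2 hML.le)
    (isSubunitCurve_const y 0 (L - M)) hσM
  rw [add_sub_cancel] at hρ hρL
  exact ⟨ρ, hρ, (hρσ 0 hM.nonneg).trans hσ0, hρL⟩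

end Subunit

/-! ### Length spaces -/

/-- A length space, in terms of parametrized curves: points at distance less than `L` are joined by
a `1`-Lipschitz curve defined on `[0, L]`. -/
def IsLengthSpace (M : Type*) [PseudoMetricSpace M] : Prop :=
  ∀ (x y : M) (L : ℝ), dist x y < L →
    ∃ γ : ℝ → M, LipschitzOnWith 1 γ (Icc 0 L) ∧ γ 0 = x ∧ γ L = y

/-- A `1`-Lipschitz curve on `[0, T]` whose endpoints are at distance at least `T - δ`. -/
structure IsAlmostShortest {M : Type*} [PseudoMetricSpace M] (δ T : ℝ) (γ : ℝ → M) : Prop where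
  lipschitz : LipschitzOnWith 1 γ (Icc 0 T)
  le_dist : T ≤ dist (γ 0) (γ T) + δ

section LengthSpace

variable {M : Type*} [PseudoMetricSpace M]

namespace IsAlmostShortest

variable {γ : ℝ → M} {δ T s t : ℝ}

theorem dist_le (h : IsAlmostShortest δ T γ) (hs : s ∈ Icc 0 T) (ht : t ∈ Icc 0 T) :
    dist (γ s) (γ t) ≤ |s - t| := by
  simpa [Real.dist_eq] using h.lipschitz.dist_le_mul s hs t ht

theorem sub_le_dist (h : IsAlmostShortest δ T γ) (hs : 0 ≤ s) (hst : s ≤ t) (ht : t ≤ T) :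
    t - s - δ ≤ dist (γ s) (γ t) := by
  have hsT := hst.trans ht
  have h1 := h.dist_le ⟨le_rfl, hs.trans hsT⟩ ⟨hs, hsT⟩
  have h2 := h.dist_le ⟨hs.trans hst, ht⟩ ⟨hs.trans hsT, le_rfl⟩
  rw [zero_sub, abs_neg, abs_of_nonneg hs] at h1
  rw [abs_sub_comm, abs_of_nonneg (sub_nonneg.2 ht)] at h2
  linarith [h.le_dist, dist_triangle4 (γ 0) (γ s) (γ t) (γ T)]

theorem abs_sub_le_dist (h : IsAlmostShortest δ T γ) (hs : s ∈ Icc 0 T) (ht : t ∈ Icc 0 T) :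
    |s - t| - δ ≤ dist (γ s) (γ t) := by
  rcases le_total s t with hst | hst
  · rw [abs_sub_comm, abs_of_nonneg (sub_nonneg.2 hst)]
    exact h.sub_le_dist hs.1 hst ht.2
  · rw [abs_of_nonneg (sub_nonneg.2 hst), dist_comm]
    exact h.sub_le_dist ht.1 hst hs.2

theorem le_increment_sub_increment (h : IsAlmostShortest δ T γ) (hs : 0 ≤ s) (hst : s ≤ t)
    (ht : t ≤ T) : 2 * (t - s) - 2 * δ ≤
      dist (γ 0) (γ t) - dist (γ 0) (γ s) - (dist (γ T) (γ t) - dist (γ T) (γ s)) := by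
  have h0 : (0 : ℝ) ∈ Icc 0 T := ⟨le_rfl, hs.trans (hst.trans ht)⟩
  have hT : T ∈ Icc 0 T := ⟨h0.2, le_rfl⟩
  have h0s := h.dist_le h0 ⟨hs, hst.trans ht⟩
  have hTt := h.dist_le hT ⟨hs.trans hst, ht⟩
  rw [zero_sub, abs_neg, abs_of_nonneg hs] at h0s
  rw [abs_of_nonneg (sub_nonneg.2 ht)] at hTt
  linarith [h.sub_le_dist le_rfl (hs.trans hst) ht, h.sub_le_dist hs (hst.trans ht) le_rfl,
    dist_comm (γ s) (γ T)]

end IsAlmostShortest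

namespace IsLengthSpace

theorem exists_isAlmostShortest (hM : IsLengthSpace M) (x y : M) :
    ∃ (n : ℕ) (γ : ℝ → M), IsAlmostShortest 2 n γ ∧ γ 0 = x ∧ γ n = y := by
  obtain ⟨γ, hγ, h0, hn⟩ := hM x y (⌈dist x y⌉₊ + 1 : ℕ) (by
    push_cast
    linarith [Nat.le_ceil (dist x y)])
  refine ⟨_, γ, ⟨hγ, ?_⟩, h0, hn⟩
  rw [h0, hn]
  push_cast
  linarith [Nat.ceil_lt_add_one (dist_nonneg (x := x) (y := y))]

theorem exists_dist_le_dist_lt (hM : IsLengthSpace M) {o y : M} {r ε : ℝ} (hr : 0 ≤ r) (hε : 0 < ε)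
    (hy : dist o y < r + ε) : ∃ z, dist o z ≤ r ∧ dist z y < ε := by
  obtain ⟨L, hL, hLε⟩ := exists_between (max_lt hy (lt_add_of_pos_right r hε))
  obtain ⟨hyL, hrL⟩ := max_lt_iff.1 hL
  obtain ⟨γ, hγ, rfl, rfl⟩ := hM o y L hyL
  have hr' : r ∈ Icc 0 L := ⟨hr, hrL.le⟩
  have h1 := hγ.dist_le_mul 0 ⟨le_rfl, hr.trans hrL.le⟩ r hr'
  have h2 := hγ.dist_le_mul r hr' L ⟨hr.trans hrL.le, le_rfl⟩
  rw [NNReal.coe_one, one_mul, Real.dist_eq, abs_sub_comm] at h1 h2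
  rw [sub_zero, abs_of_nonneg hr] at h1
  rw [abs_of_nonneg (sub_nonneg.2 hrL.le)] at h2
  exact ⟨γ r, h1, by linarith⟩

theorem exists_isCompact_closedBall_add (hM : IsLengthSpace M) [LocallyCompactSpace M] {o : M}
    {R : ℝ} (hR : 0 ≤ R) (hc : IsCompact (Metric.closedBall o R)) :
    ∃ δ > 0, IsCompact (Metric.closedBall o (R + δ)) := by
  obtain ⟨K, hK, hKs⟩ := exists_compact_superset hc
  obtain ⟨δ, hδ, hδs⟩ := hc.exists_cthickening_subset_open isOpen_interior hKs
  refine ⟨δ / 2, half_pos hδ, hK.of_isClosed_subset Metric.isClosed_closedBall fun y hy => ?_⟩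
  rw [Metric.mem_closedBall'] at hy
  obtain ⟨z, hz, hzy⟩ := hM.exists_dist_le_dist_lt hR hδ (show dist o y < R + δ by linarith)
  refine interior_subset (hδs (Metric.thickening_subset_cthickening _ _ ?_))
  rw [Metric.mem_thickening_iff]
  exact ⟨z, Metric.mem_closedBall'.2 hz, by rwa [dist_comm]⟩

theorem isCompact_closedBall_of_forall_lt (hM : IsLengthSpace M) [CompleteSpace M] {o : M} {R : ℝ}
    (hR : 0 < R) (hr : ∀ r < R, IsCompact (Metric.closedBall o r)) :
    IsCompact (Metric.closedBall o R) := by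
  rw [isCompact_iff_totallyBounded_isComplete]
  refine ⟨Metric.totallyBounded_iff.2 fun ε hε => ?_, Metric.isClosed_closedBall.isComplete⟩
  obtain ⟨r, hrmax, hrR⟩ := exists_between (max_lt hR (sub_lt_self R (half_pos hε)))
  obtain ⟨hr0, hrε⟩ := max_lt_iff.1 hrmax
  obtain ⟨t, ht, hts⟩ := Metric.totallyBounded_iff.1 (hr r hrR).totallyBounded (ε / 2)
    (half_pos hε)
  refine ⟨t, ht, fun y hy => ?_⟩
  rw [Metric.mem_closedBall'] at hy
  obtain ⟨z, hz, hzy⟩ := hM.exists_dist_le_dist_lt hr0.le (half_pos hε)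
    (show dist o y < r + ε / 2 by linarith)
  obtain ⟨w, hw, hzw⟩ := mem_iUnion₂.1 (hts (Metric.mem_closedBall'.2 hz))
  rw [Metric.mem_ball] at hzw
  refine mem_iUnion₂.2 ⟨w, hw, Metric.mem_ball.2 ?_⟩
  linarith [dist_triangle_left y w z]

/-- The Hopf–Rinow theorem. -/
theorem properSpace (hM : IsLengthSpace M) [CompleteSpace M] [LocallyCompactSpace M] :
    ProperSpace M := by
  refine ⟨fun o => ?_⟩
  by_contra! ⟨R₀, hR₀⟩
  let S : Set ℝ := {r | IsCompact (Metric.closedBall o r)}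
  have hmono : ∀ {r R}, r ≤ R → R ∈ S → r ∈ S := fun hrR hR =>
    IsCompact.of_isClosed_subset hR Metric.isClosed_closedBall
      (Metric.closedBall_subset_closedBall hrR)
  have hbdd : BddAbove S := ⟨R₀, fun r hr => le_of_not_ge fun h => hR₀ (hmono h hr)⟩
  obtain ⟨r₁, hr₁, hr₁S⟩ := Metric.exists_isCompact_closedBall o
  have hpos : 0 < sSup S := hr₁.trans_le (le_csSup hbdd hr₁S)
  have hsup : sSup S ∈ S := hM.isCompact_closedBall_of_forall_lt hpos fun r hr =>
    let ⟨_, hr', hrr'⟩ := exists_lt_of_lt_csSup ⟨r₁, hr₁S⟩ hr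
    hmono hrr'.le hr'
  obtain ⟨δ, hδ, hc⟩ := hM.exists_isCompact_closedBall_add hpos.le hsup
  linarith [le_csSup hbdd (show sSup S + δ ∈ S from hc)]

end IsLengthSpace

end LengthSpace

/-! ### Neighbourhoods in the metric compactification -/

section MetricBoundary

variable {M : Type*} [PseudoMetricSpace M]

theorem isClosed_constantFunctions : IsClosed (constantFunctions M : Set C(M, ℝ)) := by
  have h : (constantFunctions M : Set C(M, ℝ)) = ⋂ z : M, ⋂ w : M, {f | f z = f w} := by
    ext f
    simp only [mem_iInter, mem_ofPred_eq]
    constructor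
    · rintro ⟨c, rfl⟩ z w
      rfl
    · intro hf
      rcases isEmpty_or_nonempty M with hM | ⟨⟨o⟩⟩
      · exact ⟨0, ContinuousMap.ext fun z => hM.elim z⟩
      · exact ⟨f o, ContinuousMap.ext fun z => hf z o⟩
  rw [h]
  exact isClosed_iInter fun z => isClosed_iInter fun w =>
    isClosed_eq (continuous_eval_const z) (continuous_eval_const w)

theorem continuous_distClass : Continuous (distClass (M := M)) :=
  QuotientAddGroup.continuous_mk.comp <|
    ContinuousMap.continuous_of_continuous_uncurry
      (fun x : M => (⟨fun z => dist x z, by fun_prop⟩ : C(M, ℝ))) continuous_dist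

theorem isClosed_distClass_image {B : Set M} (hB : IsCompact B) : IsClosed (distClass '' B) :=
  haveI := isClosed_constantFunctions (M := M)
  (hB.image continuous_distClass).isClosed

theorem comap_metricEmbedding_nhds (ξ : MetricCompactification M) :
    comap metricEmbedding (𝓝 ξ) = comap (distClass (M := M)) (𝓝 ξ.1) := by
  rw [show 𝓝 ξ = comap Subtype.val (𝓝 ξ.1) from nhds_subtype_eq_comap]
  exact comap_comap

theorem neBot_comap_metricEmbedding (ξ : MetricCompactification M) :
    (comap metricEmbedding (𝓝 ξ)).NeBot := by
  rw [comap_metricEmbedding_nhds, comap_neBot_iff]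
  intro t ht
  obtain ⟨_, hy, x, rfl⟩ := mem_closure_iff_nhds.1 ξ.2 t ht
  exact ⟨x, hy⟩

theorem eventually_abs_dist_sub_lt {ξ : MetricCompactification M} {h : C(M, ℝ)}
    (hξ : ξ.1 = QuotientAddGroup.mk h) {B : Set M} (hB : IsCompact B) {δ : ℝ} (hδ : 0 < δ) :
    ∀ᶠ x in comap metricEmbedding (𝓝 ξ), ∀ z ∈ B, ∀ w ∈ B,
      |(dist x z - dist x w) - (h z - h w)| < δ := by
  have hnear : ∀ᶠ g in 𝓝 h, MapsTo (g - h : C(M, ℝ)) B (Metric.ball 0 (δ / 2)) := by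
    have hsub : Tendsto (fun g : C(M, ℝ) => g - h) (𝓝 h) (𝓝 0) := by
      simpa using (show Continuous fun g : C(M, ℝ) => g - h by fun_prop).tendsto h
    exact hsub.eventually (ContinuousMap.eventually_mapsTo hB Metric.isOpen_ball
      fun z _ => by simpa using hδ)
  have hlift : ∀ᶠ η in 𝓝 ξ.1, ∃ g : C(M, ℝ), QuotientAddGroup.mk g = η ∧
      MapsTo (g - h : C(M, ℝ)) B (Metric.ball 0 (δ / 2)) := by
    rw [hξ, QuotientAddGroup.nhds_eq, eventually_map]
    exact hnear.mono fun g hg => ⟨g, rfl, hg⟩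
  rw [comap_metricEmbedding_nhds]
  filter_upwards [hlift.comap distClass] with x ⟨g, hg, hgB⟩ z hz w hw
  obtain ⟨c, hc⟩ := QuotientAddGroup.eq.1 hg
  have hdist : ∀ v : M, dist x v = g v + c := fun v => by
    have := congrArg (fun f : C(M, ℝ) => f v) hc
    simp only [ContinuousMap.add_apply, ContinuousMap.neg_apply, ContinuousMap.coe_mk,
      ContinuousMap.const_apply] at this
    linarith
  have hz' := hgB hz
  have hw' := hgB hw
  rw [mem_ball_zero_iff, ContinuousMap.sub_apply, Real.norm_eq_abs, abs_lt] at hz' hw'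
  rw [hdist z, hdist w, abs_lt]
  constructor <;> linarith [hz'.1, hz'.2, hw'.1, hw'.2]

theorem IsLengthSpace.comap_metricEmbedding_le [ProperSpace M] (hM : IsLengthSpace M) (x : M) :
    comap metricEmbedding (𝓝 (metricEmbedding x)) ≤ 𝓝 x := by
  refine Metric.nhds_basis_ball.ge_iff.2 fun r hr => ?_
  filter_upwards [eventually_abs_dist_sub_lt (ξ := metricEmbedding x)
    (h := ⟨fun z => dist x z, by fun_prop⟩) rfl (isCompact_closedBall x r) hr] with y hy
  rw [Metric.mem_ball]
  by_contra! hle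
  -- `z` lies near `x` on an almost shortest curve from `y` to `x`: `d(y, ·)` decreases from `x`
  -- to `z`, whereas `d(x, ·)` increases.
  obtain ⟨z, hyz, hzx⟩ := hM.exists_dist_le_dist_lt (o := y) (y := x) (r := dist y x + r / 4 - r)
    (ε := r) (by linarith) hr (by linarith)
  have hyx := hy z (Metric.mem_closedBall.2 hzx.le) x (Metric.mem_closedBall_self hr.le)
  simp only [ContinuousMap.coe_mk, dist_self, sub_zero] at hyx
  linarith [(abs_lt.1 hyx).1, dist_triangle y z x, dist_comm x z]

theorem eventually_lt_dist_of_notMem_range [ProperSpace M] {ξ : MetricCompactification M}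
    (hξ : ξ ∉ range (metricEmbedding (M := M))) (o : M) (R : ℝ) :
    ∀ᶠ x in comap metricEmbedding (𝓝 ξ), R < dist o x := by
  have hcl := isClosed_distClass_image (isCompact_closedBall o R)
  have hnot : ξ.1 ∉ distClass '' Metric.closedBall o R := by
    rintro ⟨x, -, hx⟩
    exact hξ ⟨x, Subtype.ext hx⟩
  rw [comap_metricEmbedding_nhds]
  filter_upwards [preimage_mem_comap (hcl.isOpen_compl.mem_nhds hnot)] with x hx
  by_contra! hle
  exact hx ⟨x, Metric.mem_closedBall'.2 hle, rfl⟩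

theorem exists_forall_isAlmostShortest_lt_dist [ProperSpace M] {ξ : MetricCompactification M}
    (hξ : ξ ∉ range (metricEmbedding (M := M))) (o : M) (R : ℝ) {δ : ℝ} (hδ : 0 ≤ δ) :
    ∃ S ∈ comap metricEmbedding (𝓝 ξ), ∀ (T : ℝ) (γ : ℝ → M), IsAlmostShortest δ T γ →
      γ 0 ∈ S → γ T ∈ S → ∀ t ∈ Icc 0 T, R < dist o (γ t) := by
  obtain ⟨h, hh⟩ := QuotientAddGroup.mk_surjective ξ.1
  refine ⟨_, (eventually_lt_dist_of_notMem_range hξ o (R + (δ + 1))).and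
    (eventually_abs_dist_sub_lt hh.symm (isCompact_closedBall o (R + (δ + 1))) one_pos),
    fun T γ hγ ⟨h0, h0'⟩ ⟨_, hT'⟩ t ht => ?_⟩
  by_contra! hle
  have hT : 0 ≤ T := ht.1.trans ht.2
  have h0t := hγ.dist_le ⟨le_rfl, hT⟩ ht
  rw [zero_sub, abs_neg, abs_of_nonneg ht.1] at h0t
  have hs : t - (δ + 1) ∈ Icc 0 T :=
    ⟨by linarith [dist_triangle_right o (γ 0) (γ t)], by linarith [ht.2]⟩
  have hst := hγ.dist_le hs ht
  rw [sub_sub_cancel_left, abs_neg, abs_of_nonneg (by linarith)] at hst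
  have ht_mem : γ t ∈ Metric.closedBall o (R + (δ + 1)) :=
    Metric.mem_closedBall'.2 (by linarith)
  have hs_mem : γ (t - (δ + 1)) ∈ Metric.closedBall o (R + (δ + 1)) :=
    Metric.mem_closedBall'.2 (by linarith [dist_triangle_right o (γ (t - (δ + 1))) (γ t)])
  -- Along the curve `d(γ 0, ·)` increases and `d(γ T, ·)` decreases, but on the ball the increments
  -- of both are close to those of `h`.
  linarith [hγ.le_increment_sub_increment hs.1 (sub_le_self t (by linarith)) ht.2,
    abs_lt.1 (h0' _ ht_mem _ hs_mem), abs_lt.1 (hT' _ ht_mem _ hs_mem)]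

end MetricBoundary

/-! ### The Kobayashi topology -/

theorem exists_mem_frontier_of_isPreconnected {Z : Type*} [TopologicalSpace Z] {S V : Set Z}
    (hS : IsPreconnected S) {x y : Z} (hx : x ∈ S) (hxV : x ∈ V) (hy : y ∈ S) (hyV : y ∉ V) :
    ∃ w ∈ S, w ∈ frontier V := by
  by_contra! h
  have hcov : S ⊆ interior V ∪ (closure V)ᶜ := by
    intro w hw
    by_contra hc
    rw [mem_union, not_or, notMem_compl_iff] at hc
    exact h w hw ⟨hc.2, hc.1⟩
  have hx' : x ∈ interior V := (hcov hx).resolve_right fun h => h (subset_closure hxV)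
  have hy' : y ∈ (closure V)ᶜ := (hcov hy).resolve_left fun h => hyV (interior_subset h)
  obtain ⟨w, -, hw, hw'⟩ := hS _ _ isOpen_interior isClosed_closure.isOpen_compl hcov
    ⟨x, hx, hx'⟩ ⟨y, hy, hy'⟩
  exact hw' (interior_subset_closure hw)

theorem isCompact_frontier_interior {Z : Type*} [TopologicalSpace Z] [T2Space Z] {N : Set Z}
    (hN : IsCompact N) : IsCompact (frontier (interior N)) :=
  hN.of_isClosed_subset isClosed_frontier
    (frontier_subset_closure.trans (closure_minimal interior_subset hN.isClosed))

section KobayashiTopology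

variable {E : Type*} [NormedAddCommGroup E] [NormedSpace ℂ E]
variable {X : Type*} [TopologicalSpace X] [ChartedSpace E X] [IsManifold 𝓘(ℂ, E) 1 X]

theorem eventually_exists_isHolomorphicDisc (p : X) {a : ℂ} (ha : a ≠ 0) :
    ∀ᶠ q in 𝓝 p, ∃ f : ℂ → X, IsHolomorphicDisc E f ∧ f 0 = p ∧ f a = q := by
  set φ := chartAt E p
  have hp : p ∈ φ.source := mem_chart_source E p
  obtain ⟨r, hr, hball⟩ := Metric.isOpen_iff.1 φ.open_target (φ p) (φ.map_source hp)
  have hnear : ∀ᶠ q in 𝓝 p, φ q ∈ Metric.ball (φ p) (‖a‖ * r) :=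
    (φ.continuousAt hp).eventually (Metric.ball_mem_nhds _ (mul_pos (norm_pos_iff.2 ha) hr))
  filter_upwards [hnear, φ.open_source.mem_nhds hp] with q hq hqs
  let g : ℂ → E := fun ζ => φ p + ζ • a⁻¹ • (φ q - φ p)
  have hv : ‖a⁻¹ • (φ q - φ p)‖ < r := by
    rwa [norm_smul, norm_inv, inv_mul_lt_iff₀ (norm_pos_iff.2 ha), ← mem_ball_iff_norm]
  have hg : MapsTo g (Metric.ball (0 : ℂ) 1) φ.target := fun ζ hζ => by
    refine hball (mem_ball_iff_norm.2 ?_)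
    rw [add_sub_cancel_left, norm_smul]
    exact (mul_le_of_le_one_left (norm_nonneg _) (mem_ball_zero_iff.1 hζ).le).trans_lt hv
  have hgd : Differentiable ℂ g := by fun_prop
  have hφ : MDifferentiableOn 𝓘(ℂ, E) 𝓘(ℂ, E) φ.symm φ.target :=
    mdifferentiableOn_atlas_symm (chart_mem_atlas E p)
  refine ⟨fun ζ => φ.symm (g ζ), hφ.comp hgd.mdifferentiable.mdifferentiableOn hg, ?_, ?_⟩
  · simp [g, φ.left_inv hp]
  · simp [g, smul_smul, ha, φ.left_inv hqs]

theorem eventually_kobayashiDist_lt (p : X) {ε : ℝ} (hε : 0 < ε) :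
    ∀ᶠ q in 𝓝 p, kobayashiDist E p q < ε := by
  have htanh : ((Real.tanh (ε / 2) : ℝ) : ℂ) ≠ 0 := by
    rw [Complex.ofReal_ne_zero, Real.tanh_eq_sinh_div_cosh]
    exact (div_pos (Real.sinh_pos_iff.2 (half_pos hε)) (Real.cosh_pos _)).ne'
  filter_upwards [eventually_exists_isHolomorphicDisc (E := E) p htanh] with q ⟨f, hf, hf0, hfq⟩
  have h := hf.kobayashiDist_tanh_le 0 (ε / 2)
  rw [Real.tanh_zero, Complex.ofReal_zero, hf0, hfq, zero_sub, abs_neg,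
    abs_of_pos (half_pos hε)] at h
  exact h.trans_lt (half_lt_self hε)

variable [ConnectedSpace X]

theorem continuous_toKobayashiSpace :
    Continuous (toKobayashiSpace : X → KobayashiSpace E X) := by
  refine continuous_iff_continuousAt.2 fun p => Metric.tendsto_nhds.2 fun ε hε => ?_
  filter_upwards [eventually_kobayashiDist_lt (E := E) p hε] with q hq
  rwa [dist_comm, dist_toKobayashiSpace]

theorem continuous_kobayashiDist (x : X) : Continuous fun y => kobayashiDist E x y :=
  (continuous_const (y := toKobayashiSpace (E := E) x)).dist continuous_toKobayashiSpace

theorem IsKobayashiHyperbolic.exists_pos_forall_le_kobayashiDist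
    (hX : IsKobayashiHyperbolic E X) {x : X} {C : Set X} (hC : IsCompact C) (hx : x ∉ C) :
    ∃ m > 0, ∀ w ∈ C, m ≤ kobayashiDist E x w := by
  rcases C.eq_empty_or_nonempty with rfl | hne
  · exact ⟨1, one_pos, fun w hw => hw.elim⟩
  · obtain ⟨w₀, hw₀, hmin⟩ := hC.exists_isMinOn hne
      (continuous_kobayashiDist (E := E) x).continuousOn
    refine ⟨kobayashiDist E x w₀, (kobayashiDist_nonneg _ _).lt_of_ne' fun h0 => hx ?_,
      fun w hw => hmin hw⟩
    rwa [hX x w₀ h0]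

variable [CompleteSpace E]

variable (E X) in
theorem isLengthSpace_kobayashiSpace : IsLengthSpace (KobayashiSpace E X) := by
  intro x y L h
  obtain ⟨σ, hσ, h0, hL⟩ := exists_isSubunitCurve (E := E) (X := X) (x := x) (y := y) h
  exact ⟨fun t => toKobayashiSpace (σ t), hσ.lipschitz, h0, hL⟩

theorem exists_mem_frontier_kobayashiDist_lt {V : Set X} {x y : X} (hx : x ∈ V) (hy : y ∉ V)
    {r : ℝ} (hr : kobayashiDist E x y < r) : ∃ w ∈ frontier V, kobayashiDist E x w < r := by
  obtain ⟨L, hL, hLr⟩ := exists_between hr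
  have hL0 : 0 ≤ L := (kobayashiDist_nonneg _ _).trans hL.le
  obtain ⟨σ, hσ, rfl, rfl⟩ := exists_isSubunitCurve (E := E) hL
  obtain ⟨_, ⟨t, ht, rfl⟩, hw⟩ := exists_mem_frontier_of_isPreconnected
    (isPreconnected_Icc.image _ hσ.continuousOn) (mem_image_of_mem _ (left_mem_Icc.2 hL0)) hx
    (mem_image_of_mem _ (right_mem_Icc.2 hL0)) hy
  refine ⟨_, hw, (hσ.dist_le (left_mem_Icc.2 hL0) ht).trans_lt ?_⟩
  rw [zero_sub, abs_neg, abs_of_nonneg ht.1]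
  exact ht.2.trans_lt hLr

/-- The identity map from `(X, k_X)` to `X`. -/
def ofKobayashiSpace (x : KobayashiSpace E X) : X := x

namespace IsKobayashiHyperbolic

variable [T2Space X] [LocallyCompactSpace X]

theorem exists_forall_kobayashiDist_lt_mem (hX : IsKobayashiHyperbolic E X) (x : X) {U : Set X}
    (hU : U ∈ 𝓝 x) : ∃ m > 0, ∀ y, kobayashiDist E x y < m → y ∈ U := by
  obtain ⟨N, hNx, hNU, hN⟩ := local_compact_nhds hU
  have hx : x ∈ interior N := mem_interior_iff_mem_nhds.2 hNx
  obtain ⟨m, hm, hle⟩ := hX.exists_pos_forall_le_kobayashiDist (isCompact_frontier_interior hN)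
    ((disjoint_frontier_iff_isOpen.2 isOpen_interior).notMem_of_mem_right hx)
  refine ⟨m, hm, fun y hy => hNU (interior_subset ?_)⟩
  by_contra hyN
  obtain ⟨w, hw, hwm⟩ := exists_mem_frontier_kobayashiDist_lt hx hyN hy
  exact hwm.not_ge (hle w hw)

/-- The Kobayashi distance of a hyperbolic manifold induces the manifold topology. -/
def homeomorph (hX : IsKobayashiHyperbolic E X) : X ≃ₜ KobayashiSpace E X where
  toFun := toKobayashiSpace
  invFun := ofKobayashiSpace
  left_inv _ := rfl
  right_inv _ := rfl
  continuous_toFun := continuous_toKobayashiSpace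
  continuous_invFun := by
    refine continuous_iff_continuousAt.2 fun x U hU => ?_
    obtain ⟨m, hm, h⟩ := hX.exists_forall_kobayashiDist_lt_mem (ofKobayashiSpace x) hU
    refine mem_of_superset (Metric.ball_mem_nhds x hm) fun y hy => h _ ?_
    exact (Metric.mem_ball' (x := x) (y := y)).1 hy

theorem properSpace (hX : IsKobayashiHyperbolic E X) [CompleteSpace (KobayashiSpace E X)] :
    ProperSpace (KobayashiSpace E X) :=
  haveI : LocallyCompactSpace (KobayashiSpace E X) :=
    hX.homeomorph.symm.isClosedEmbedding.locallyCompactSpace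
  (isLengthSpace_kobayashiSpace E X).properSpace

end IsKobayashiHyperbolic

end KobayashiTopology

/-! ### Quasi-geodesics -/

section QuasiGeodesic

variable {E : Type*} [NormedAddCommGroup E] [NormedSpace ℂ E]
variable {X : Type*} [TopologicalSpace X] [ChartedSpace E X] [IsManifold 𝓘(ℂ, E) 1 X]
  [ConnectedSpace X]

variable (E) in
/-- A subunit curve on `[a, b]` which is a quasi-geodesic: only the lower bound is a condition, the
upper one holds for all subunit curves. -/
structure IsSubunitQuasiGeodesic (lam kap : ℝ) (σ : ℝ → X) (a b : ℝ) : Prop extends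
    IsSubunitCurve E σ a b where
  lower : ∀ s ∈ Icc a b, ∀ t ∈ Icc a b, 1 / lam * |s - t| - kap ≤ kobayashiDist E (σ s) (σ t)

variable (E) in
/-- `F` is a quasi-isometric embedding of a pseudometric space into `(X, k_X)` with constants
`lam` and `kap`. -/
structure IsQuasiIsometricEmbeddingWith {M : Type*} [PseudoMetricSpace M] (lam kap : ℝ)
    (F : M → X) : Prop where
  lower : ∀ x y : M, 1 / lam * dist x y - kap ≤ kobayashiDist E (F x) (F y)
  upper : ∀ x y : M, kobayashiDist E (F x) (F y) ≤ lam * dist x y + kap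

namespace IsSubunitQuasiGeodesic

variable {lam kap a b : ℝ} {σ : ℝ → X}

theorem mono (h : IsSubunitQuasiGeodesic E lam kap σ a b) {c d : ℝ} (hac : a ≤ c) (hdb : d ≤ b) :
    IsSubunitQuasiGeodesic E lam kap σ c d where
  toIsSubunitCurve := h.toIsSubunitCurve.mono hac hdb
  lower s hs t ht := h.lower s (Icc_subset_Icc hac hdb hs) t (Icc_subset_Icc hac hdb ht)

theorem isAlmostGeodesic (h : IsSubunitQuasiGeodesic E lam kap σ a b) (hlam : 1 ≤ lam)
    (hkap : 0 ≤ kap) : IsAlmostGeodesic E lam kap (b - a) (fun t => σ (t + a)) := by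
  have hshift := h.toIsSubunitCurve.comp_add_right a
  rw [sub_self] at hshift
  refine hshift.isAlmostGeodesic hlam hkap fun s hs t ht => ?_
  have hlow := h.lower (s + a) ⟨by linarith [hs.1], by linarith [hs.2]⟩ (t + a)
    ⟨by linarith [ht.1], by linarith [ht.2]⟩
  rwa [add_sub_add_right_eq_sub] at hlow

end IsSubunitQuasiGeodesic

variable [CompleteSpace E] {L : ℝ}

theorem exists_isSubunitCurve_through {z : ℕ → X} (hL : 0 ≤ L) (n : ℕ)
    (hz : ∀ i < n, kobayashiDist E (z i) (z (i + 1)) < L) :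
    ∃ σ : ℝ → X, IsSubunitCurve E σ 0 (n * L) ∧ ∀ i ≤ n, σ (i * L) = z i := by
  induction n with
  | zero =>
    refine ⟨fun _ => z 0, isSubunitCurve_const _ _ _, fun i hi => ?_⟩
    rw [Nat.le_zero.1 hi]
  | succ n ih =>
    obtain ⟨σ, hσ, hσz⟩ := ih fun i hi => hz i (hi.trans n.lt_succ_self)
    obtain ⟨τ, hτ, hτ0, hτL⟩ := exists_isSubunitCurve (hz n n.lt_succ_self)
    obtain ⟨ρ, hρ, hρσ, hρL⟩ := hσ.exists_concat (by positivity) hL hτ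
      ((hσz n le_rfl).trans hτ0.symm)
    have hsucc : ((n + 1 : ℕ) : ℝ) * L = n * L + L := by push_cast; ring
    refine ⟨ρ, by rwa [hsucc], fun i hi => ?_⟩
    rcases Nat.le_or_eq_of_le_succ hi with hi | rfl
    · rw [hρσ _ (by gcongr), hσz i hi]
    · rw [hsucc, hρL, hτL]

variable {g : ℝ → X} {n : ℕ}

theorem exists_isSubunitCurve_forall_kobayashiDist_le
    (hg : ∀ s ∈ Icc (0 : ℝ) n, ∀ t ∈ Icc (0 : ℝ) n, |s - t| ≤ 1 →
      kobayashiDist E (g s) (g t) < L) :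
    ∃ σ : ℝ → X, IsSubunitCurve E σ 0 (n * L) ∧ σ 0 = g 0 ∧ σ (n * L) = g n ∧
      ∀ s ∈ Icc (0 : ℝ) n, kobayashiDist E (g s) (σ (s * L)) ≤ 2 * L := by
  have hnat : ∀ i ≤ n, (i : ℝ) ∈ Icc (0 : ℝ) n := fun i hi =>
    ⟨Nat.cast_nonneg i, Nat.cast_le.2 hi⟩
  have hL : 0 ≤ L := (kobayashiDist_nonneg _ _).trans
    (hg n (hnat n le_rfl) n (hnat n le_rfl) (by simp)).le
  obtain ⟨σ, hσ, hσg⟩ := exists_isSubunitCurve_through (E := E) (z := fun i => g i) hL n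
    fun i hi => hg _ (hnat i hi.le) _ (hnat (i + 1) hi) (by simp)
  refine ⟨σ, hσ, by simpa using hσg 0 n.zero_le, hσg n le_rfl, fun s hs => ?_⟩
  have hfloor : ⌊s⌋₊ ≤ n := Nat.floor_le_of_le hs.2
  have hle := Nat.floor_le hs.1
  have hlt := (Nat.lt_floor_add_one s).le
  have h1 := hg s hs _ (hnat _ hfloor) (by rw [abs_of_nonneg] <;> linarith)
  have h2 := hσ.dist_le (s := ⌊s⌋₊ * L) (t := s * L)
    ⟨by positivity, by gcongr⟩
    ⟨mul_nonneg hs.1 hL, mul_le_mul_of_nonneg_right hs.2 hL⟩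
  rw [hσg _ hfloor, ← sub_mul, abs_mul, abs_of_nonneg hL, abs_of_nonpos (by linarith)] at h2
  nlinarith [kobayashiDist_triangle (E := E) (g s) (g ⌊s⌋₊) (σ (s * L))]

theorem exists_isSubunitQuasiGeodesic_near {lam c : ℝ} (hL : 0 < L)
    (hg : ∀ s ∈ Icc (0 : ℝ) n, ∀ t ∈ Icc (0 : ℝ) n, |s - t| ≤ 1 →
      kobayashiDist E (g s) (g t) < L)
    (hg' : ∀ s ∈ Icc (0 : ℝ) n, ∀ t ∈ Icc (0 : ℝ) n,
      1 / lam * |s - t| - c ≤ kobayashiDist E (g s) (g t)) :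
    ∃ σ : ℝ → X, IsSubunitQuasiGeodesic E (lam * L) (c + 4 * L) σ 0 (n * L) ∧ σ 0 = g 0 ∧
      σ (n * L) = g n ∧
      ∀ u ∈ Icc 0 (n * L), ∃ s ∈ Icc (0 : ℝ) n, kobayashiDist E (g s) (σ u) ≤ 2 * L := by
  obtain ⟨σ, hσ, h0, hn, hnear⟩ := exists_isSubunitCurve_forall_kobayashiDist_le hg
  have hmem : ∀ u ∈ Icc 0 (n * L), u / L ∈ Icc (0 : ℝ) n := fun u hu =>
    ⟨div_nonneg hu.1 hL.le, (div_le_iff₀ hL).2 hu.2⟩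
  have hnear' : ∀ u ∈ Icc 0 (n * L), kobayashiDist E (g (u / L)) (σ u) ≤ 2 * L := fun u hu => by
    simpa only [div_mul_cancel₀ u hL.ne'] using hnear _ (hmem u hu)
  refine ⟨σ, ⟨hσ, fun u hu v hv => ?_⟩, h0, hn, fun u hu => ⟨_, hmem u hu, hnear' u hu⟩⟩
  have hlow := hg' _ (hmem u hu) _ (hmem v hv)
  have hscale : 1 / lam * |u / L - v / L| = 1 / (lam * L) * |u - v| := by
    rw [← sub_div, abs_div, abs_of_pos hL]
    ring
  have h1 := kobayashiDist_triangle (E := E) (g (u / L)) (σ u) (g (v / L))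
  have h2 := kobayashiDist_triangle (E := E) (σ u) (σ v) (g (v / L))
  rw [kobayashiDist_comm (σ v)] at h2
  linarith [hnear' u hu, hnear' v hv]

theorem IsQuasiIsometricEmbeddingWith.exists_isSubunitQuasiGeodesic {M : Type*}
    [PseudoMetricSpace M] {lam kap δ : ℝ} {F : M → X}
    (hF : IsQuasiIsometricEmbeddingWith E lam kap F) (hlam : 0 ≤ lam) (hkap : 0 ≤ kap)
    {γ : ℝ → M} (hγ : IsAlmostShortest δ n γ) :
    ∃ (σ : ℝ → X) (T : ℝ), 0 ≤ T ∧
      IsSubunitQuasiGeodesic E (lam * (lam + kap + 1))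
        (1 / lam * δ + kap + 4 * (lam + kap + 1)) σ 0 T ∧
      σ 0 = F (γ 0) ∧ σ T = F (γ n) ∧ ∀ u ∈ Icc 0 T, ∃ s ∈ Icc (0 : ℝ) n,
        kobayashiDist E (F (γ s)) (σ u) ≤ 2 * (lam + kap + 1) := by
  have hstep : ∀ s ∈ Icc (0 : ℝ) n, ∀ t ∈ Icc (0 : ℝ) n, |s - t| ≤ 1 →
      kobayashiDist E (F (γ s)) (F (γ t)) < lam + kap + 1 := fun s hs t ht hst => by
    nlinarith [hF.upper (γ s) (γ t), hγ.dist_le hs ht]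
  have hlow : ∀ s ∈ Icc (0 : ℝ) n, ∀ t ∈ Icc (0 : ℝ) n,
      1 / lam * |s - t| - (1 / lam * δ + kap) ≤ kobayashiDist E (F (γ s)) (F (γ t)) :=
    fun s hs t ht => by
      have := mul_le_mul_of_nonneg_left (hγ.abs_sub_le_dist hs ht) (one_div_nonneg.2 hlam)
      linarith [hF.lower (γ s) (γ t)]
  obtain ⟨σ, hσ⟩ := exists_isSubunitQuasiGeodesic_near (g := fun s => F (γ s))
    (show 0 < lam + kap + 1 by positivity) hstep hlow
  exact ⟨σ, n * (lam + kap + 1), by positivity, hσ⟩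

end QuasiGeodesic

/-! ### Convergence in the end compactification -/

section Ends

theorem eventually_mem_map_comap_nhds {M W Z : Type*} [TopologicalSpace W] {i : M → W}
    {f : M → Z} {w : W} {S : Set Z} (hS : S ∈ map f (comap i (𝓝 w))) :
    ∀ᶠ w' in 𝓝 w, S ∈ map f (comap i (𝓝 w')) := by
  obtain ⟨V, hV, hVS⟩ := mem_comap.1 (mem_map.1 hS)
  filter_upwards [eventually_mem_nhds_iff.2 hV] with w' hw'
  exact mem_map.2 (mem_comap.2 ⟨V, hw', hVS⟩)

variable {Z : Type*} [TopologicalSpace Z] {K : CompactExhaustion Z}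

namespace TopEnd

variable (e : TopEnd K) {j : ℕ}

theorem subset_compl (j : ℕ) : e.F j ⊆ (K j)ᶜ := by
  obtain ⟨x, -, hx⟩ := e.isComponent j
  exact hx ▸ connectedComponentIn_subset _ _

theorem isPreconnected (j : ℕ) : IsPreconnected (e.F j) := by
  obtain ⟨x, -, hx⟩ := e.isComponent j
  exact hx ▸ isPreconnected_connectedComponentIn

theorem eq_connectedComponentIn {z : Z} (hz : z ∈ e.F j) :
    e.F j = connectedComponentIn (K j)ᶜ z := by
  obtain ⟨x, -, hx⟩ := e.isComponent j
  rw [hx] at hz ⊢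
  exact connectedComponentIn_eq hz

theorem antitone : Antitone e.F := antitone_nat_of_succ_le e.decreasing

theorem closure_succ_subset (j : ℕ) : closure (e.F (j + 1)) ⊆ e.F j := by
  intro z hz
  have hzK : z ∉ K j := fun hzK => by
    obtain ⟨y, hyK, hy⟩ := mem_closure_iff.1 hz _ isOpen_interior (K.subset_interior_succ j hzK)
    exact e.subset_compl _ hy (interior_subset hyK)
  obtain ⟨y, hy⟩ := closure_nonempty_iff.1 ⟨z, hz⟩
  have hpre : IsPreconnected (insert z (e.F (j + 1))) :=
    (e.isPreconnected (j + 1)).subset_closure (subset_insert _ _)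
      (insert_subset hz subset_closure)
  rw [e.eq_connectedComponentIn (e.decreasing j hy)]
  exact hpre.subset_connectedComponentIn (mem_insert_of_mem _ hy)
    (insert_subset hzK ((e.decreasing j).trans (e.subset_compl j))) (mem_insert _ _)

theorem notMem_of_isCompact {l : Filter Z} [l.NeBot] (he : ∀ j, e.F j ∈ l) {C : Set Z}
    (hC : IsCompact C) : C ∉ l := by
  intro hCl
  obtain ⟨j, hj⟩ := K.exists_superset_of_isCompact hC
  obtain ⟨z, hz, hz'⟩ := Filter.nonempty_of_mem (inter_mem hCl (he j))
  exact e.subset_compl j hz' (hj hz)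

end TopEnd

/-- A filter on `Z` converges to a point of `Z`, or to an end, in the end compactification. -/
def ConvergesTo (l : Filter Z) : EndCompactification K → Prop
  | .ofPoint z => l ≤ 𝓝 z
  | .ofEnd e => ∀ j, e.F j ∈ l

namespace ConvergesTo

variable {l l' : Filter Z} {a : EndCompactification K}

theorem mono (h : ConvergesTo l a) (hl : l' ≤ l) : ConvergesTo l' a := by
  cases a with
  | ofPoint z => exact hl.trans h
  | ofEnd e => exact fun j => hl (h j)

theorem exists_mem_eq_ofPoint [T2Space Z] [l.NeBot] (h : ConvergesTo l a) {N : Set Z}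
    (hN : IsCompact N) (hNl : N ∈ l) : ∃ z ∈ N, a = .ofPoint z := by
  cases a with
  | ofPoint z => exact ⟨z, hN.isClosed.mem_of_tendsto (tendsto_id'.2 h) hNl, rfl⟩
  | ofEnd e => exact absurd hNl (e.notMem_of_isCompact h hN)

theorem mem_endNhd [l.NeBot] (h : ConvergesTo l a) {e : TopEnd K} {j : ℕ}
    (he : e.F (j + 1) ∈ l) : a ∈ endNhd e j := by
  cases a with
  | ofPoint z =>
    have hz : z ∈ closure (e.F (j + 1)) := mem_closure_of_tendsto (tendsto_id'.2 h) he
    exact Or.inl ⟨z, e.closure_succ_subset j hz, rfl⟩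
  | ofEnd e' =>
    refine Or.inr ⟨e', fun ν hν => ?_, rfl⟩
    obtain ⟨y, hy, hy'⟩ := Filter.nonempty_of_mem (inter_mem he (h ν))
    rw [e'.eq_connectedComponentIn hy',
      e.eq_connectedComponentIn (e.antitone (hν.trans j.le_succ) hy)]

end ConvergesTo

theorem exists_continuous_extension [T2Space Z] [LocallyCompactSpace Z] {M W : Type*}
    [TopologicalSpace W] {i : M → W} (hi : ∀ w, (comap i (𝓝 w)).NeBot) {f : M → Z}
    (hf : ∀ w, ∃ a : EndCompactification K, ConvergesTo (map f (comap i (𝓝 w))) a) :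
    ∃ g : W → EndCompactification K, Continuous g ∧ ∀ x, g (i x) = .ofPoint (f x) := by
  choose g hg using hf
  have htendsto : ∀ w, Tendsto g (𝓝 w) (endCompactificationNhds (g w)) := by
    intro w
    have hw := hg w
    cases hgw : g w with
    | ofPoint z =>
      intro U hU
      rw [hgw] at hw
      obtain ⟨N, hNz, hNU, hN⟩ := local_compact_nhds (mem_map.1 hU)
      rw [mem_map]
      filter_upwards [eventually_mem_map_comap_nhds (hw hNz)] with w' hw'
      obtain ⟨z', hz', hgw'⟩ := (hg w').exists_mem_eq_ofPoint hN hw'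
      rw [mem_preimage, hgw']
      exact hNU hz'
    | ofEnd e =>
      rw [hgw] at hw
      refine tendsto_iInf.2 fun j => tendsto_principal.2 ?_
      filter_upwards [eventually_mem_map_comap_nhds (hw (j + 1))] with w' hw'
      exact (hg w').mem_endNhd hw'
  refine ⟨g, continuous_def.2 fun U hU => isOpen_iff_mem_nhds.2 fun w hw =>
    htendsto w (hU (g w) hw), fun x => ?_⟩
  have hx : pure (f x) ≤ map f (comap i (𝓝 (i x))) := by
    rw [← Filter.map_pure]
    exact map_mono (map_le_iff_le_comap.1 (by rw [Filter.map_pure]; exact pure_le_nhds _))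
  obtain ⟨_, rfl, h⟩ := ((hg (i x)).mono hx).exists_mem_eq_ofPoint isCompact_singleton
    (mem_pure.2 rfl)
  exact h

/-- Any two points of a suitable member of the filter lie in a connected set that does not meet
both of two given disjoint compact sets. -/
def IsAsymptoticallyConnected (l : Filter Z) : Prop :=
  ∀ A B : Set Z, IsCompact A → IsCompact B → Disjoint A B → ∃ S ∈ l, ∀ z ∈ S, ∀ w ∈ S,
    ∃ P, IsPreconnected P ∧ z ∈ P ∧ w ∈ P ∧ (Disjoint P A ∨ Disjoint P B)

namespace IsAsymptoticallyConnected

variable [T2Space Z] {l : Filter Z}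

theorem le_nhds_of_clusterPt [LocallyCompactSpace Z] (hl : IsAsymptoticallyConnected l) {z : Z}
    (hz : ClusterPt z l) : l ≤ 𝓝 z := by
  intro U hU
  obtain ⟨N, hNz, hNU, hN⟩ := local_compact_nhds hU
  obtain ⟨A, hAz, hAN, hA⟩ :=
    local_compact_nhds (isOpen_interior.mem_nhds (mem_interior_iff_mem_nhds.2 hNz))
  have hdisj : Disjoint A (frontier (interior N)) :=
    (disjoint_frontier_iff_isOpen.2 isOpen_interior).symm.mono_left hAN
  obtain ⟨S, hS, hSP⟩ := hl A _ hA (isCompact_frontier_interior hN) hdisj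
  obtain ⟨x, hxA, hxS⟩ := clusterPt_iff_nonempty.1 hz hAz hS
  refine mem_of_superset hS fun w hw => hNU (interior_subset ?_)
  obtain ⟨P, hP, hxP, hwP, hPA | hPN⟩ := hSP x hxS w hw
  · exact absurd hxA (hPA.notMem_of_mem_left hxP)
  · by_contra hwN
    obtain ⟨y, hyP, hyN⟩ := exists_mem_frontier_of_isPreconnected hP hxP (hAN hxA) hwP hwN
    exact hPN.notMem_of_mem_left hyP hyN

theorem exists_connectedComponentIn_mem [l.NeBot] (hl : IsAsymptoticallyConnected l)
    (hK : ∀ j, (K j)ᶜ ∈ l) (j : ℕ) : ∃ x ∈ (K j)ᶜ, connectedComponentIn (K j)ᶜ x ∈ l := by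
  have hfr : IsCompact (frontier (K (j + 1))) :=
    (K.isCompact _).of_isClosed_subset isClosed_frontier (K.isCompact _).isClosed.frontier_subset
  have hdisj : Disjoint (frontier (K (j + 1))) (K j) :=
    disjoint_left.2 fun w hw hwK => hw.2 (K.subset_interior_succ j hwK)
  obtain ⟨S, hS, hSP⟩ := hl _ _ hfr (K.isCompact j) hdisj
  obtain ⟨x, hxS, hxK⟩ := Filter.nonempty_of_mem (inter_mem hS (hK (j + 1)))
  refine ⟨x, fun h => hxK (K.subset_succ j h), mem_of_superset hS fun w hw => ?_⟩
  obtain ⟨P, hP, hxP, hwP, hPA⟩ := hSP x hxS w hw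
  have hPK : Disjoint P (K j) := hPA.elim (fun hPfr => disjoint_left.2 fun y hyP hyK => by
    obtain ⟨v, hvP, hv⟩ := exists_mem_frontier_of_isPreconnected hP hyP (K.subset_succ j hyK)
      hxP hxK
    exact hPfr.notMem_of_mem_left hvP hv) id
  exact hP.subset_connectedComponentIn hxP hPK.subset_compl_right hwP

theorem exists_convergesTo [LocallyCompactSpace Z] [l.NeBot] (hl : IsAsymptoticallyConnected l)
    (K : CompactExhaustion Z) : ∃ a : EndCompactification K, ConvergesTo l a := by
  by_cases hcl : ∃ z, ClusterPt z l
  · obtain ⟨z, hz⟩ := hcl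
    exact ⟨.ofPoint z, hl.le_nhds_of_clusterPt hz⟩
  push Not at hcl
  have hK : ∀ j, (K j)ᶜ ∈ l := fun j => by
    by_contra hj
    have : (l ⊓ 𝓟 (K j)).NeBot := ⟨fun h => hj (inf_principal_eq_bot.1 h)⟩
    obtain ⟨z, -, hz⟩ := K.isCompact j (f := l ⊓ 𝓟 (K j)) inf_le_right
    exact hcl z (hz.mono inf_le_left)
  choose x hxK hxl using hl.exists_connectedComponentIn_mem hK
  refine ⟨.ofEnd ⟨fun j => connectedComponentIn (K j)ᶜ (x j), fun j => ⟨_, hxK j, rfl⟩,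
    fun j => ?_⟩, hxl⟩
  obtain ⟨y, hy, hy'⟩ := Filter.nonempty_of_mem (inter_mem (hxl (j + 1)) (hxl j))
  rw [connectedComponentIn_eq hy, connectedComponentIn_eq hy']
  exact connectedComponentIn_mono _ (compl_subset_compl.2 (K.subset_succ j))

end IsAsymptoticallyConnected

end Ends

/-! ### Visibility -/

section Visibility

variable {E : Type*} [NormedAddCommGroup E] [NormedSpace ℂ E]
variable {Y : Type*} [TopologicalSpace Y] [ChartedSpace E Y] {Ω : TopologicalSpace.Opens Y}

/-- The inclusion of `Ω` into its closure. -/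
def toClosure (x : Ω) : closure (Ω : Set Y) := ⟨x, subset_closure x.2⟩

theorem isOpenEmbedding_toClosure : Topology.IsOpenEmbedding (toClosure (Ω := Ω)) := by
  refine ⟨.inclusion subset_closure, ?_⟩
  have hrange : range (toClosure (Ω := Ω)) = Subtype.val ⁻¹' (Ω : Set Y) := by
    ext z
    exact ⟨fun ⟨x, hx⟩ => hx ▸ x.2, fun hz => ⟨⟨z, hz⟩, rfl⟩⟩
  exact hrange ▸ Ω.isOpen.preimage continuous_subtype_val

theorem exists_isCompact_image_toClosure_mem_nhds [LocallyCompactSpace Ω]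
    {z : closure (Ω : Set Y)} (hz : (z : Y) ∈ Ω) :
    ∃ C : Set Ω, IsCompact C ∧ toClosure '' C ∈ 𝓝 z := by
  obtain ⟨C, hC, hCz⟩ := exists_compact_mem_nhds (⟨z, hz⟩ : Ω)
  exact ⟨C, hC, isOpenEmbedding_toClosure.isOpenMap.image_mem_nhds hCz⟩

variable [IsManifold 𝓘(ℂ, E) 1 Y] [ConnectedSpace Ω] {lam kap : ℝ}

variable (E) in
/-- The subunit quasi-geodesics of `Ω` whose pair of endpoints lies in `S` all meet a fixed compact
subset of `Ω`. -/
def QuasiGeodesicsMeetCompact (lam kap : ℝ)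
    (S : Set (closure (Ω : Set Y) × closure (Ω : Set Y))) : Prop :=
  ∃ C : Set Ω, IsCompact C ∧ ∀ (σ : ℝ → Ω) (a b : ℝ), a ≤ b →
    IsSubunitQuasiGeodesic E lam kap σ a b → (toClosure (σ a), toClosure (σ b)) ∈ S →
    ∃ t ∈ Icc a b, σ t ∈ C

namespace QuasiGeodesicsMeetCompact

variable {S S' : Set (closure (Ω : Set Y) × closure (Ω : Set Y))}

theorem empty : QuasiGeodesicsMeetCompact (Ω := Ω) E lam kap ∅ :=
  ⟨∅, isCompact_empty, fun _ _ _ _ _ h => h.elim⟩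

theorem mono (h : QuasiGeodesicsMeetCompact E lam kap S') (hS : S ⊆ S') :
    QuasiGeodesicsMeetCompact E lam kap S := by
  obtain ⟨C, hC, h⟩ := h
  exact ⟨C, hC, fun σ a b hab hσ hs => h σ a b hab hσ (hS hs)⟩

theorem union (h : QuasiGeodesicsMeetCompact E lam kap S)
    (h' : QuasiGeodesicsMeetCompact E lam kap S') :
    QuasiGeodesicsMeetCompact E lam kap (S ∪ S') := by
  obtain ⟨C, hC, h⟩ := h
  obtain ⟨D, hD, h'⟩ := h'
  refine ⟨C ∪ D, hC.union hD, fun σ a b hab hσ hs => ?_⟩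
  rcases hs with hs | hs
  · obtain ⟨t, ht, htC⟩ := h σ a b hab hσ hs
    exact ⟨t, ht, Or.inl htC⟩
  · obtain ⟨t, ht, htD⟩ := h' σ a b hab hσ hs
    exact ⟨t, ht, Or.inr htD⟩

end QuasiGeodesicsMeetCompact

theorem HasVisibilityProperty.exists_mem_nhds_of_notMem (hΩ : HasVisibilityProperty E Ω)
    (hlam : 1 ≤ lam) (hkap : 0 < kap) {p q : closure (Ω : Set Y)} (hp : (p : Y) ∉ Ω)
    (hq : (q : Y) ∉ Ω) (hpq : p ≠ q) :
    ∃ S ∈ 𝓝 (p, q), QuasiGeodesicsMeetCompact E lam kap S := by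
  have hfr : ∀ z : closure (Ω : Set Y), (z : Y) ∉ Ω → (z : Y) ∈ frontier (Ω : Set Y) :=
    fun z hz => Ω.isOpen.frontier_eq ▸ ⟨z.2, hz⟩
  obtain ⟨U, hU, V, hV, -, C, hC, hmeet⟩ :=
    hΩ lam kap hlam hkap p (hfr p hp) q (hfr q hq) (Subtype.coe_ne_coe.2 hpq)
  refine ⟨(Subtype.val ⁻¹' U) ×ˢ (Subtype.val ⁻¹' V), prod_mem_nhds
    (continuous_subtype_val.continuousAt hU) (continuous_subtype_val.continuousAt hV),
    C, hC, fun σ a b hab hσ hs => ?_⟩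
  obtain ⟨t, ht, htC⟩ := hmeet (b - a) (fun t => σ (t + a)) (sub_nonneg.2 hab)
    (hσ.isAlmostGeodesic hlam hkap.le) (by simpa [toClosure] using hs.1)
    (by simpa [toClosure] using hs.2)
  exact ⟨t + a, ⟨by linarith [ht.1], by linarith [ht.2]⟩, htC⟩

theorem HasVisibilityProperty.exists_mem_nhds [LocallyCompactSpace Ω]
    (hΩ : HasVisibilityProperty E Ω) (hlam : 1 ≤ lam) (hkap : 0 < kap)
    {p q : closure (Ω : Set Y)} (hpq : p ≠ q) :
    ∃ S ∈ 𝓝 (p, q), QuasiGeodesicsMeetCompact E lam kap S := by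
  by_cases hp : (p : Y) ∈ Ω
  · obtain ⟨C, hC, hCp⟩ := exists_isCompact_image_toClosure_mem_nhds hp
    exact ⟨(toClosure '' C) ×ˢ univ, prod_mem_nhds hCp univ_mem, C, hC, fun σ a b hab _ hs =>
      ⟨a, left_mem_Icc.2 hab, isOpenEmbedding_toClosure.injective.mem_set_image.1 hs.1⟩⟩
  by_cases hq : (q : Y) ∈ Ω
  · obtain ⟨C, hC, hCq⟩ := exists_isCompact_image_toClosure_mem_nhds hq
    exact ⟨univ ×ˢ (toClosure '' C), prod_mem_nhds univ_mem hCq, C, hC, fun σ a b hab _ hs =>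
      ⟨b, right_mem_Icc.2 hab, isOpenEmbedding_toClosure.injective.mem_set_image.1 hs.2⟩⟩
  exact hΩ.exists_mem_nhds_of_notMem hlam hkap hp hq hpq

theorem HasVisibilityProperty.quasiGeodesicsMeetCompact_prod [LocallyCompactSpace Ω]
    (hΩ : HasVisibilityProperty E Ω) (hlam : 1 ≤ lam) (hkap : 0 < kap)
    {A B : Set (closure (Ω : Set Y))} (hA : IsCompact A) (hB : IsCompact B) (hAB : Disjoint A B) :
    QuasiGeodesicsMeetCompact E lam kap (A ×ˢ B) := by
  refine (hA.prod hB).induction_on .empty (fun _ _ hS h => h.mono hS) (fun _ _ h h' => h.union h')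
    ?_
  rintro ⟨p, q⟩ ⟨hp, hq⟩
  obtain ⟨S, hS, h⟩ := hΩ.exists_mem_nhds hlam hkap (hAB.ne_of_mem hp hq)
  exact ⟨S, mem_nhdsWithin_of_mem_nhds hS, h⟩

variable (E) in
/-- For each compact set `C`, some member of the filter has all its pairs of points joined by
subunit quasi-geodesics that avoid `C`. -/
def IsJoinedOffCompacts {X : Type*} [TopologicalSpace X] [ChartedSpace E X]
    [IsManifold 𝓘(ℂ, E) 1 X] [ConnectedSpace X] (lam kap : ℝ) (l : Filter X) : Prop :=
  ∀ C : Set X, IsCompact C → ∃ S ∈ l, ∀ z ∈ S, ∀ w ∈ S, ∃ (σ : ℝ → X) (T : ℝ), 0 ≤ T ∧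
    IsSubunitQuasiGeodesic E lam kap σ 0 T ∧ σ 0 = z ∧ σ T = w ∧ ∀ t ∈ Icc 0 T, σ t ∉ C

theorem HasVisibilityProperty.isAsymptoticallyConnected_map [LocallyCompactSpace Ω]
    (hΩ : HasVisibilityProperty E Ω) (hlam : 1 ≤ lam) (hkap : 0 < kap) {l : Filter Ω}
    (hl : IsJoinedOffCompacts E lam kap l) : IsAsymptoticallyConnected (map toClosure l) := by
  intro A B hA hB hAB
  obtain ⟨C, hC, hmeet⟩ := (hΩ.quasiGeodesicsMeetCompact_prod hlam hkap hA hB hAB).union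
    (hΩ.quasiGeodesicsMeetCompact_prod hlam hkap hB hA hAB.symm)
  obtain ⟨S, hS, hSσ⟩ := hl C hC
  refine ⟨toClosure '' S, image_mem_map hS, ?_⟩
  rintro _ ⟨z, hz, rfl⟩ _ ⟨w, hw, rfl⟩
  obtain ⟨σ, T, hT, hσ, rfl, rfl, havoid⟩ := hSσ z hz w hw
  have hsub : ∀ a b, 0 ≤ a → a ≤ b → b ≤ T →
      (toClosure (σ a), toClosure (σ b)) ∉ A ×ˢ B ∪ B ×ˢ A := fun a b ha hab hb hs => by
    obtain ⟨t, ht, htC⟩ := hmeet σ a b hab (hσ.mono ha hb) hs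
    exact havoid t (Icc_subset_Icc ha hb ht) htC
  refine ⟨(fun t => toClosure (σ t)) '' Icc 0 T, isPreconnected_Icc.image _
    (isOpenEmbedding_toClosure.continuous.comp_continuousOn hσ.continuousOn),
    ⟨0, left_mem_Icc.2 hT, rfl⟩, ⟨T, right_mem_Icc.2 hT, rfl⟩, ?_⟩
  by_contra! hmeets
  obtain ⟨_, ⟨s, hs, rfl⟩, hsA⟩ := not_disjoint_iff.1 hmeets.1
  obtain ⟨_, ⟨t, ht, rfl⟩, htB⟩ := not_disjoint_iff.1 hmeets.2
  rcases le_total s t with hst | hts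
  · exact hsub s t hs.1 hst ht.2 (Or.inl ⟨hsA, htB⟩)
  · exact hsub t s ht.1 hts hs.2 (Or.inr ⟨htB, hsA⟩)

end Visibility

theorem IsQuasiIsometricEmbeddingWith.isJoinedOffCompacts
    {M : Type*} [PseudoMetricSpace M] [ProperSpace M] (hM : IsLengthSpace M)
    {E : Type*} [NormedAddCommGroup E] [NormedSpace ℂ E] [CompleteSpace E]
    {X : Type*} [TopologicalSpace X] [ChartedSpace E X] [IsManifold 𝓘(ℂ, E) 1 X]
    [ConnectedSpace X] {F : M → X} {lam kap : ℝ} (hF : IsQuasiIsometricEmbeddingWith E lam kap F)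
    (hlam : 0 < lam) (hkap : 0 ≤ kap) {ξ : MetricCompactification M}
    (hξ : ξ ∉ range metricEmbedding) :
    IsJoinedOffCompacts E (lam * (lam + kap + 1)) (1 / lam * 2 + kap + 4 * (lam + kap + 1))
      (map F (comap metricEmbedding (𝓝 ξ))) := by
  intro C hC
  obtain ⟨o⟩ : Nonempty M := (neBot_comap_metricEmbedding ξ).nonempty
  obtain ⟨A, hA⟩ := hC.bddAbove_image (continuous_kobayashiDist (E := E) (F o)).continuousOn
  obtain ⟨S, hS, hSγ⟩ := exists_forall_isAlmostShortest_lt_dist hξ o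
    (lam * (A + 2 * (lam + kap + 1) + kap)) zero_le_two
  refine ⟨F '' S, image_mem_map hS, ?_⟩
  rintro _ ⟨x, hx, rfl⟩ _ ⟨y, hy, rfl⟩
  obtain ⟨n, γ, hγ, rfl, rfl⟩ := hM.exists_isAlmostShortest x y
  obtain ⟨σ, T, hT, hσ, hσ0, hσT, hnear⟩ := hF.exists_isSubunitQuasiGeodesic hlam.le hkap hγ
  refine ⟨σ, T, hT, hσ, hσ0, hσT, fun t ht htC => ?_⟩
  obtain ⟨s, hs, hst⟩ := hnear t ht
  have hfar := hSγ n γ hγ hx hy s hs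
  have hC : kobayashiDist E (F o) (σ t) ≤ A := hA ⟨σ t, htC, rfl⟩
  have htri := kobayashiDist_triangle (E := E) (F o) (σ t) (F (γ s))
  rw [kobayashiDist_comm (σ t)] at htri
  have hlow := hF.lower o (γ s)
  have hclose : 1 / lam * dist o (γ s) ≤ A + 2 * (lam + kap + 1) + kap := by linarith
  rw [one_div, inv_mul_le_iff₀ hlam] at hclose
  exact hclose.not_gt hfar

theorem locallyCompactSpace_of_compactExhaustion {Z : Type*} [TopologicalSpace Z] [T2Space Z]
    (K : CompactExhaustion Z) : LocallyCompactSpace Z :=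
  have : WeaklyLocallyCompactSpace Z :=
    ⟨fun z =>
      let ⟨j, hj⟩ := K.exists_mem_nhds z
      ⟨K j, K.isCompact j, hj⟩⟩
  inferInstance

theorem theorem1p3_general
    {M : Type*} [PseudoMetricSpace M] [ProperSpace M] (hM : IsLengthSpace M)
    {E : Type*} [NormedAddCommGroup E] [NormedSpace ℂ E] [CompleteSpace E]
    {Y : Type*} [TopologicalSpace Y] [ChartedSpace E Y] [IsManifold 𝓘(ℂ, E) 1 Y] [T2Space Y]
    (Ω : TopologicalSpace.Opens Y) (hΩ : IsConnected (Ω : Set Y))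
    (hΩv : HasVisibilityProperty E Ω) (K : CompactExhaustion (closure (Ω : Set Y)))
    (F : M → Ω) (hFc : Continuous F) {lam kap : ℝ} (hlam : 1 ≤ lam) (hkap : 0 ≤ kap)
    (hF : IsQuasiIsometricEmbeddingWith E lam kap F) :
    ∃ Fext : MetricCompactification M → EndCompactification K,
      Continuous Fext ∧ ∀ x, Fext (metricEmbedding x) = .ofPoint (toClosure (F x)) := by
  have : ConnectedSpace Ω := isConnected_iff_connectedSpace.1 hΩ
  have := locallyCompactSpace_of_compactExhaustion K
  have : LocallyCompactSpace Ω := isOpenEmbedding_toClosure.locallyCompactSpace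
  refine exists_continuous_extension neBot_comap_metricEmbedding fun ξ => ?_
  have := neBot_comap_metricEmbedding ξ
  by_cases hξ : ξ ∈ range metricEmbedding
  · obtain ⟨x, rfl⟩ := hξ
    exact ⟨.ofPoint (toClosure (F x)), ((isOpenEmbedding_toClosure.continuous.comp hFc).tendsto
      x).mono_left (hM.comap_metricEmbedding_le x)⟩
  · have hjoined := hF.isJoinedOffCompacts hM (by linarith) hkap hξ
    exact (hΩv.isAsymptoticallyConnected_map (by nlinarith) (by positivity)
      hjoined).exists_convergesTo K

end

theorem theorem1p3
    {E : Type*} [NormedAddCommGroup E] [NormedSpace ℂ E] [FiniteDimensional ℂ E]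
    {X : Type*} [TopologicalSpace X] [ChartedSpace E X] [IsManifold 𝓘(ℂ, E) 1 X]
    [T2Space X] [SecondCountableTopology X] [ConnectedSpace X]
    {E' : Type*} [NormedAddCommGroup E'] [NormedSpace ℂ E'] [FiniteDimensional ℂ E']
    {Y : Type*} [TopologicalSpace Y] [ChartedSpace E' Y] [IsManifold 𝓘(ℂ, E') 1 Y]
    [T2Space Y] [SecondCountableTopology Y]
    (hX : IsKobayashiHyperbolic E X) (hXc : CompleteSpace (KobayashiSpace E X))
    (Ω : TopologicalSpace.Opens Y) (hΩ : IsConnected (Ω : Set Y)) (hΩY : Ω ≠ ⊤)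
    (hΩh : IsKobayashiHyperbolic E' Ω) (hΩv : HasVisibilityProperty E' Ω)
    (K : CompactExhaustion (closure (Ω : Set Y)))
    (F : X → Ω) (hFc : Continuous F) (hFq : IsQuasiIsometricEmbedding E E' F) :
    ∃ Fext : MetricCompactification (KobayashiSpace E X) → EndCompactification K,
      Continuous Fext ∧
        ∀ x : X, Fext (metricEmbedding (toKobayashiSpace x)) =
          EndCompactification.ofPoint ⟨(F x : Y), subset_closure (F x).2⟩ := by
  have : CompleteSpace E := FiniteDimensional.complete ℂ E
  have : CompleteSpace E' := FiniteDimensional.complete ℂ E'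
  have : ProperSpace E := FiniteDimensional.proper ℂ E
  have : LocallyCompactSpace X := ChartedSpace.locallyCompactSpace E X
  have : ProperSpace (KobayashiSpace E X) := hX.properSpace
  obtain ⟨lam, kap, hlam, hkap, hF⟩ := hFq
  exact theorem1p3_general (isLengthSpace_kobayashiSpace E X) Ω hΩ hΩv K (F ∘ ofKobayashiSpace)
    (hFc.comp hX.homeomorph.symm.continuous) hlam hkap
    ⟨fun x y => (hF x y).1, fun x y => (hF x y).2⟩
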